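/- **Setting.** There are $P\ge 1$ processors. Each processor owns finitely many (possibly no) serial tasks; the size of a task is the positive integer number of time steps that it takes. The tasks of a processor, in a given order, are the leaves of a binary tree that is balanced: at every node the numbers of tasks on the two branches differ by at most one. Let $T_1$ be the total size of all tasks, let $T_\infty'$ be the largest height (number of edges) of the tree of a processor, and let $T_\infty=\lceil\lg P\rceil+T_\infty'+(\text{size of the largest task})$, the span of the computation in which the $P$ roots are joined by a binary tree of height $\lceil \lg P\rceil$. Assume $T_\infty'\ge 1$, i.e. some processor owns at least two tasks. **Localized work stealing.** Initially each processor that owns tasks works on its own tree. A processor works through its current tree from left to right, without interrupting a task, and sets the other branches aside. Each processor has a list, initially empty, of other processors that are working on its work. In each time step, every processor that has work performs one unit of work on its current task, and every free processor makes one steal attempt. If its list is nonempty, the attempt is a steal-back, on a uniformly random processor from its list; otherwise it is a general steal, on a uniformly random processor among those that still have work left (no attempt if there is none). The choices of one time step are independent given the past. A victim can lose the topmost branch that it has set aside, provided that there is one and, for a steal-back, that it is work of the stealing processor. If several attempts on a victim could succeed in a time step, an arbitrary one of them succeeds (chosen by any, possibly randomized, rule that sees the past and the current attempts) and the others fail.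 The successful processor works on the branch it took from the next time step on. A processor that takes work of another owner in a general steal is added to the list of the owner. A processor on which a steal-back fails because it has no work of the owner that could be taken is removed from the list of the owner. The execution time is the number of time steps until all tasks are completed. **Theorem 8.** For every constant $c$ there is a constant $C>0$, depending only on $c$, such that the following holds for every $P$, every computation as above and every rule for contention. Remove any at most $cP$ serial tasks from consideration. For each processor $i$ let $M_i$ be the ratio between its largest and its smallest remaining serial task ($M_i=1$ if none of its tasks remains), and let $M=\max_i M_i$. Then the expected execution time of the localized work-stealing algorithm is at most $$\frac{T_1}{P}+C\,T_\infty\min(M,T_\infty').$$ -/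

import Mathlib

namespace LocalizedStealing

/-! ### Serial tasks and the trees that carry them -/

/-- A binary tree whose leaves are serial tasks; a leaf records the size of its task, i.e. the number
of time steps that the task takes. -/
inductive TaskTree : Type
  | leaf (size : ℕ) : TaskTree
  | node (left right : TaskTree) : TaskTree

/-- The sizes of the serial tasks of a tree, in their left-to-right order. -/
def TaskTree.sizes : TaskTree → List ℕ
  | .leaf s => [s]
  | .node l r => l.sizes ++ r.sizes

/-- The height of a tree (number of edges on a longest path from the root to a leaf). -/
def TaskTree.height : TaskTree → ℕ
  | .leaf _ => 0
  | .node l r => max l.height r.height + 1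

/-- At every node, the numbers of serial tasks on the two branches differ by at most one. -/
def TaskTree.Balanced : TaskTree → Prop
  | .leaf _ => True
  | .node l r => l.sizes.length ≤ r.sizes.length + 1 ∧ r.sizes.length ≤ l.sizes.length + 1 ∧
      l.Balanced ∧ r.Balanced

/-- The work of `P` processors: each processor owns a balanced binary tree of serial tasks of positive
sizes, or (`none`) no serial task at all. -/
structure Workload (P : ℕ) where
  tree : Fin P → Option TaskTree
  balanced : ∀ i t, tree i = some t → t.Balanced
  size_pos : ∀ i t, tree i = some t → ∀ s ∈ t.sizes, 0 < s

namespace Workload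

variable {P : ℕ}

/-- The sizes of the serial tasks that processor `i` owns. -/
def sizes (W : Workload P) (i : Fin P) : List ℕ :=
  match W.tree i with
  | none => []
  | some t => t.sizes

/-- The serial tasks of the computation: an owner, and a position among the leaves of its tree. -/
abbrev Task (W : Workload P) : Type := Σ i : Fin P, Fin (W.sizes i).length

/-- The size of a serial task. -/
def taskSize (W : Workload P) (x : W.Task) : ℕ := (W.sizes x.1).get x.2

/-- The work `T₁`: the total size of all serial tasks. -/
def work (W : Workload P) : ℕ := ∑ x : W.Task, W.taskSize x

/-- The size of the largest serial task (`0` if there is none). -/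
def largestTask (W : Workload P) : ℕ := Finset.univ.sup W.taskSize

/-- `T∞'`: the largest height of a processor's own tree. -/
def treeHeight (W : Workload P) : ℕ :=
  Finset.univ.sup fun i : Fin P => match W.tree i with
    | none => 0
    | some t => t.height

/-- The span `T∞`: the height of the large tree, in which the `P` roots are joined by a binary tree of
height `⌈lg P⌉`, plus the size of the largest serial task. -/
def span (W : Workload P) : ℕ := Nat.clog 2 P + W.treeHeight + W.largestTask

open Classical in
/-- The sizes of the serial tasks of processor `i` that remain when the tasks in `R` are removed from
consideration. -/
noncomputable def remainingSizes (W : Workload P) (R : Finset W.Task) (i : Fin P) : Finset ℕ :=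
  (Finset.univ.filter fun x : W.Task => x.1 = i ∧ x ∉ R).image W.taskSize

open Classical in
/-- `Mᵢ`: the ratio between the largest and the smallest remaining serial task of processor `i`. It is
`1`, the least possible value of such a ratio, if no task of `i` remains. -/
noncomputable def ratio (W : Workload P) (R : Finset W.Task) (i : Fin P) : ℝ :=
  if h : (W.remainingSizes R i).Nonempty then
    ((W.remainingSizes R i).max' h : ℝ) / ((W.remainingSizes R i).min' h : ℝ)
  else 1

/-- `M = maxᵢ Mᵢ`. -/
noncomputable def maxRatio (W : Workload P) (R : Finset W.Task) : ℝ := ⨆ i : Fin P, W.ratio R i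

end Workload

/-! ### States of the machine -/

/-- What a busy processor holds: the owner of the work, the number of time steps that the serial task in
execution still needs, and the deque of the branches that it has set aside, the most recent (deepest)
one first and the topmost one last. -/
structure Holding (P : ℕ) where
  owner : Fin P
  timeLeft : ℕ
  deque : List TaskTree

/-- Begin with a tree: walk down to its first serial task and set aside the other branches. -/
def Holding.start {P : ℕ} (o : Fin P) : TaskTree → List TaskTree → Holding P
  | .leaf s, d => ⟨o, s, d⟩
  | .node l r, d => Holding.start o l (r :: d)

/-- One time step of work. A processor that completes its serial task goes on with the branch that it
set aside most recently; if there is none, it becomes free. -/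
def Holding.advance {P : ℕ} (h : Holding P) : Option (Holding P) :=
  if 1 < h.timeLeft then some { h with timeLeft := h.timeLeft - 1 }
  else match h.deque with
    | [] => none
    | t :: d => some (Holding.start h.owner t d)

/-- A state of the machine: what each processor holds (`none` for a free processor), and for each
processor its list of the other processors that are working on its work. -/
structure State (P : ℕ) where
  holds : Fin P → Option (Holding P)
  helpers : Fin P → Finset (Fin P)

/-- At the beginning each processor has its own tree, and all lists are empty. -/
def State.initial {P : ℕ} (W : Workload P) : State P where
  holds i := (W.tree i).map fun t => Holding.start i t []
  helpers _ := ∅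

/-- All work is done: no processor holds any. -/
def State.Finished {P : ℕ} (s : State P) : Prop := ∀ i, s.holds i = none

/-! ### Steal attempts -/

/-- The steal attempts of one time step: `a i = some j` if `i` attempts to steal from `j`, and
`a i = none` if `i` makes no attempt. -/
abbrev Attempts (P : ℕ) : Type := Fin P → Option (Fin P)

/-- The processors among which `i` chooses its victim. A busy processor does not steal. A free processor
with a nonempty list makes a steal-back, from the processors on its list; a free processor with an empty
list makes a general steal, from the processors that still have work left to do. -/
def targets {P : ℕ} (s : State P) (i : Fin P) : Finset (Fin P) :=
  if (s.holds i).isSome then ∅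
  else if (s.helpers i).Nonempty then s.helpers i
  else Finset.univ.filter fun j => (s.holds j).isSome

/-- The possible values of `a i`: every target, or only `none` if there is no target. -/
def options {P : ℕ} (s : State P) (i : Fin P) : Finset (Option (Fin P)) :=
  if (targets s i).Nonempty then (targets s i).image some else {none}

theorem options_nonempty {P : ℕ} (s : State P) (i : Fin P) : (options s i).Nonempty := by
  unfold options
  split_ifs with h
  · exact h.image some
  · exact Finset.singleton_nonempty none

theorem piFinset_options_nonempty {P : ℕ} (s : State P) :
    (Fintype.piFinset (options s)).Nonempty := by
  rw [Fintype.piFinset_nonempty]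
  exact options_nonempty s

/-- All victims of a time step are chosen independently and uniformly, i.e. the vector of the attempts is
uniform on the product of the sets of options. -/
noncomputable def attemptLaw {P : ℕ} (s : State P) : PMF (Attempts P) :=
  PMF.uniformOfFinset (Fintype.piFinset (options s)) (piFinset_options_nonempty s)

/-- `i` attempts to steal from `j`, and `j` has a branch that `i` could take: the deque of `j` is not
empty and, if the attempt is a steal-back, the work of `j` is owned by `i`. -/
def Eligible {P : ℕ} (s : State P) (a : Attempts P) (i j : Fin P) : Prop :=
  a i = some j ∧ ∃ h, s.holds j = some h ∧ h.deque ≠ [] ∧ ((s.helpers i).Nonempty → h.owner = i)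

/-- Given winners `w`, the attempt of `i` on `j` succeeds. -/
def Succeeds {P : ℕ} (s : State P) (a : Attempts P) (w : Fin P → Fin P) (i j : Fin P) : Prop :=
  Eligible s a i j ∧ w j = i

/-- What has happened so far: the past states with the attempts made in them, the latest first. -/
abbrev History (P : ℕ) : Type := List (State P × Attempts P)

/-- A rule for contention: given the history, the present state and the attempts, it selects, possibly at
random, for each victim `j` the attempt `w j` that succeeds, among all attempts on `j` that could. -/
structure ContentionRule (P : ℕ) where
  select : History P → State P → Attempts P → PMF (Fin P → Fin P)
  valid : ∀ past s a, ∀ w ∈ (select past s a).support, ∀ j,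
    (∃ i, Eligible s a i j) → Eligible s a (w j) j

/-! ### The execution -/

open Classical in
/-- What processor `p` holds after the time step. A busy processor loses the topmost branch of its deque
if there was a successful attempt on it, and works for one unit of time. A free processor gets the
topmost branch of its victim if its attempt succeeds. -/
noncomputable def nextHolding {P : ℕ} (s : State P) (a : Attempts P) (w : Fin P → Fin P)
    (p : Fin P) : Option (Holding P) :=
  match s.holds p with
  | some h =>
      if ∃ i, Succeeds s a w i p then Holding.advance { h with deque := h.deque.dropLast }
      else h.advance
  | none =>
      match a p with
      | none => none
      | some j =>
          if Succeeds s a w p j then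
            match s.holds j with
            | none => none
            | some h => h.deque.getLast?.map fun t => Holding.start h.owner t []
          else none

open Classical in
/-- The list of `o` after the time step. If `o` made a steal-back that was unsuccessful because its
target has no work of `o` to be taken any more, the target is removed; every other processor that took
work of `o` in a general steal is added. -/
noncomputable def nextHelpers {P : ℕ} (s : State P) (a : Attempts P) (w : Fin P → Fin P)
    (o : Fin P) : Finset (Fin P) :=
  ((s.helpers o).filter fun j => ¬ (a o = some j ∧ ¬ Eligible s a o j)) ∪
    Finset.univ.filter fun k => k ≠ o ∧ s.helpers k = ∅ ∧
      ∃ j h, Succeeds s a w k j ∧ s.holds j = some h ∧ h.owner = o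

/-- One time step. -/
noncomputable def State.next {P : ℕ} (s : State P) (a : Attempts P) (w : Fin P → Fin P) : State P where
  holds := nextHolding s a w
  helpers := nextHelpers s a w

/-- The joint law of the history and of the state after `t` time steps. -/
noncomputable def run {P : ℕ} (σ : ContentionRule P) (W : Workload P) : ℕ → PMF (History P × State P)
  | 0 => PMF.pure ([], State.initial W)
  | t + 1 => (run σ W t).bind fun x =>
      (attemptLaw x.2).bind fun a =>
        (σ.select x.1 x.2 a).map fun w => ((x.2, a) :: x.1, x.2.next a w)

/-- The expected execution time. The execution time `T` is the number of time steps until all work is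
done, so `T > t` means that the state after `t` steps is not finished, and `E[T] = ∑ₜ Pr[T > t]`. -/
noncomputable def expectedTime {P : ℕ} (σ : ContentionRule P) (W : Workload P) : ENNReal :=
  ∑' t : ℕ, (run σ W t).toOuterMeasure {x | ¬ x.2.Finished}

end LocalizedStealing

/-! In a time step each of the `P` processors works, makes a general steal or makes a steal-back
(`card_busy_add`). It suffices to find a nonnegative potential of the state that falls on average by
at least `P` in each unfinished step, whatever the contention rule does: by additive drift
(`expectedTime_le_of_drift`) the expected time is then at most its initial value divided by `P`. The
potential has one term for each of the three activities.

Work is paid for by the remaining volume, which gives `T₁ / P`. General steals are paid for by a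
multiple of `P * log (1 + Φ)`, where `Φ` sums powers of 3 whose exponents bound the steals and time
steps that a holding can last. A general attempt on a nonempty deque always causes a theft there,
which leaves two holdings with at most a third of the potential each; a holding with an empty deque
loses a constant fraction by working. A given busy processor is attacked with probability at least
`g / (2P)` if there are `g` general thieves, so the logarithm falls on average by `g / (12P)`
(`log_potential_drift`); initially it is `O(T∞)`. There remains a third potential `S` that pays for
steal-backs; if general steals raise it by `β` each on average, this costs `O(β T∞)` more
(`expectedTime_le_of_stealBacks`).

For the bound with `T∞'`, `S` is the sum of the ranks of the deques held by non-owners and of the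
lengths of all lists. A steal-back aimed at a stealable branch costs the victim a rank, whoever wins
it; any other steal-back shortens a list. A general steal adds at most `T∞' + 1`
(`heightPotential_next_le`).

For the bound with `M`, consider a free owner and the work `X` that its helpers hold and that can be
stolen back. While the owner works on a recovered branch of volume `T`, every helper either finishes
or also does `T` units. By balance the topmost branch has a constant fraction of the tasks of its
holding, so `T` is at least a fraction of order `1 / M` of the victim's share of `X`. Averaged over
the uniform victim, the progress in `M * log X` and in the number of helpers is at least a constant
(`le_stealValue`, `card_helpers_le_sum_stealValue`). To book this progress at the moment of the
steal, the potential contains `log X + Q / X`, where `Q` is the part of `X` not certain to be done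
by the time the owner is free again. The tasks removed from consideration are charged separately:
each is affected by at most `T∞'` thefts (`steal_exposure_le`). -/

namespace LocalizedStealing

/-! ### Weights of trees and deques -/

/-- The sum of `f` over the sizes of the leaves. -/
def TaskTree.weight (f : ℕ → ℕ) (t : TaskTree) : ℕ := (t.sizes.map f).sum

@[simp] theorem TaskTree.weight_leaf (f : ℕ → ℕ) (s : ℕ) : (TaskTree.leaf s).weight f = f s := by
  simp [TaskTree.weight, TaskTree.sizes]

@[simp] theorem TaskTree.weight_node (f : ℕ → ℕ) (l r : TaskTree) :
    (TaskTree.node l r).weight f = l.weight f + r.weight f := by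
  simp [TaskTree.weight, TaskTree.sizes]

theorem TaskTree.length_sizes (t : TaskTree) : t.sizes.length = t.weight fun _ => 1 := by
  simp [TaskTree.weight]

theorem TaskTree.sizes_ne_nil (t : TaskTree) : t.sizes ≠ [] := by
  induction t with
  | leaf s => simp [TaskTree.sizes]
  | node l r hl hr => simp [TaskTree.sizes, hl]

theorem TaskTree.one_le_length (t : TaskTree) : 1 ≤ t.sizes.length :=
  List.length_pos_iff.2 t.sizes_ne_nil

theorem TaskTree.length_sizes_le (t : TaskTree) : t.sizes.length ≤ 2 ^ t.height := by
  induction t with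
  | leaf s => simp [TaskTree.sizes, TaskTree.height]
  | node l r hl hr =>
    have h1 : 2 ^ l.height ≤ 2 ^ max l.height r.height :=
      Nat.pow_le_pow_right (by norm_num) (le_max_left _ _)
    have h2 : 2 ^ r.height ≤ 2 ^ max l.height r.height :=
      Nat.pow_le_pow_right (by norm_num) (le_max_right _ _)
    simp only [TaskTree.sizes, TaskTree.height, List.length_append, pow_succ]
    omega

theorem TaskTree.weight_mono {f g : ℕ → ℕ} (t : TaskTree) (h : ∀ s ∈ t.sizes, f s ≤ g s) :
    t.weight f ≤ t.weight g :=
  List.sum_le_sum h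

theorem TaskTree.weight_add (f g : ℕ → ℕ) (t : TaskTree) :
    t.weight (fun s => f s + g s) = t.weight f + t.weight g := by
  induction t with
  | leaf s => simp
  | node l r hl hr => simp [hl, hr]; omega

theorem TaskTree.weight_mul (c : ℕ) (f : ℕ → ℕ) (t : TaskTree) :
    t.weight (fun s => c * f s) = c * t.weight f := by
  induction t with
  | leaf s => simp
  | node l r hl hr => simp [hl, hr]; ring

/-- The sum of `f` over the sizes of the leaves of the trees of a deque. -/
def dequeWeight (f : ℕ → ℕ) (d : List TaskTree) : ℕ := (d.map (TaskTree.weight f)).sum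

@[simp] theorem dequeWeight_nil (f : ℕ → ℕ) : dequeWeight f [] = 0 := rfl

@[simp] theorem dequeWeight_cons (f : ℕ → ℕ) (t : TaskTree) (d : List TaskTree) :
    dequeWeight f (t :: d) = t.weight f + dequeWeight f d := by
  simp [dequeWeight]

@[simp] theorem dequeWeight_append (f : ℕ → ℕ) (d e : List TaskTree) :
    dequeWeight f (d ++ e) = dequeWeight f d + dequeWeight f e := by
  simp [dequeWeight]

theorem dequeWeight_mono {f g : ℕ → ℕ} (d : List TaskTree)
    (h : ∀ t ∈ d, ∀ s ∈ t.sizes, f s ≤ g s) : dequeWeight f d ≤ dequeWeight g d :=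
  List.sum_le_sum fun t ht => t.weight_mono (h t ht)

theorem le_weight_of_forall {c : ℕ} {f : ℕ → ℕ} (t : TaskTree) (h : ∀ s ∈ t.sizes, c ≤ f s) :
    c * t.sizes.length ≤ t.weight f := by
  have := t.weight_mono (f := fun _ => c * 1) (g := f) (by simpa using h)
  rwa [TaskTree.weight_mul c (fun _ => 1), ← TaskTree.length_sizes] at this

/-! ### Starting with a tree -/

theorem start_owner {P : ℕ} (o : Fin P) (t : TaskTree) (d : List TaskTree) :
    (Holding.start o t d).owner = o := by
  induction t generalizing d with
  | leaf s => rfl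
  | node l r hl hr => exact hl _

theorem start_weight {P : ℕ} (f : ℕ → ℕ) (o : Fin P) (t : TaskTree) (d : List TaskTree) :
    f (Holding.start o t d).timeLeft + dequeWeight f (Holding.start o t d).deque =
      t.weight f + dequeWeight f d := by
  induction t generalizing d with
  | leaf s => simp [Holding.start]
  | node l r hl hr => simp [Holding.start, hl]; omega

theorem start_timeLeft_mem {P : ℕ} (o : Fin P) (t : TaskTree) (d : List TaskTree) :
    (Holding.start o t d).timeLeft ∈ t.sizes := by
  induction t generalizing d with
  | leaf s => simp [Holding.start, TaskTree.sizes]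
  | node l r hl hr => exact List.mem_append_left _ (hl _)

theorem start_sizes {P : ℕ} (p : ℕ → Prop) (o : Fin P) (t : TaskTree) (d : List TaskTree)
    (ht : ∀ s ∈ t.sizes, p s) (hd : ∀ u ∈ d, ∀ s ∈ u.sizes, p s) :
    ∀ u ∈ (Holding.start o t d).deque, ∀ s ∈ u.sizes, p s := by
  induction t generalizing d with
  | leaf s => simpa [Holding.start] using hd
  | node l r hl hr =>
    refine hl _ (fun s hs => ht s (List.mem_append_left _ hs)) ?_
    intro u hu
    rcases List.mem_cons.1 hu with rfl | hu
    · exact fun s hs => ht s (List.mem_append_right _ hs)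
    · exact hd u hu

/-! ### The rank of a deque -/

/-- A bound on how often the topmost branch can be removed along any line of descent. -/
def rank : List TaskTree → ℕ
  | [] => 0
  | t :: d => max (t.height + d.length + 1) (rank d)

/-- Each edge walked down lowers the height by one and lengthens the deque by one, so their sum does
not grow. Starting on a fresh tree thus gives rank at most its height. -/
theorem start_rank {P : ℕ} (o : Fin P) (t : TaskTree) (d : List TaskTree) :
    rank (Holding.start o t d).deque ≤ max (t.height + d.length) (rank d) := by
  induction t generalizing d with
  | leaf s => simp [Holding.start]
  | node l r hl hr =>
    refine (hl _).trans ?_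
    simp only [rank, TaskTree.height, List.length_cons]
    omega

/-- The topmost branch is counted in the length term of every branch below it. Hence a theft lowers
the rank of the victim, and the thief starts with a smaller rank too. -/
theorem rank_append_singleton (d : List TaskTree) (t : TaskTree) :
    rank d + 1 ≤ rank (d ++ [t]) ∧ t.height + 1 ≤ rank (d ++ [t]) := by
  induction d with
  | nil => simp [rank]
  | cons u d ih => simp only [rank, List.cons_append, List.length_append, List.length_singleton]; omega

theorem rank_pos {d : List TaskTree} (h : d ≠ []) : 1 ≤ rank d := by
  cases d with
  | nil => exact absurd rfl h
  | cons t d => simp [rank]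

/-! ### Balanced deques -/

/-- Each branch of the deque is balanced and has about as many leaves as there are below it; `c` is the
number of tasks below the deepest branch. -/
def BalancedDeque : ℕ → List TaskTree → Prop
  | _, [] => True
  | c, t :: d => t.Balanced ∧ c ≤ t.sizes.length + 1 ∧ BalancedDeque (c + t.sizes.length) d

theorem BalancedDeque.anti {c c' : ℕ} (h : c ≤ c') {d : List TaskTree} (hd : BalancedDeque c' d) :
    BalancedDeque c d := by
  induction d generalizing c c' with
  | nil => trivial
  | cons t d ih => exact ⟨hd.1, h.trans hd.2.1, ih (by omega) hd.2.2⟩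

/-- At each node the branch set aside has, up to one, as many tasks as the branch entered, and
everything entered later lies inside the latter. -/
theorem start_balanced {P : ℕ} (o : Fin P) (t : TaskTree) (d : List TaskTree) (ht : t.Balanced)
    (hd : BalancedDeque t.sizes.length d) : BalancedDeque 1 (Holding.start o t d).deque := by
  induction t generalizing d with
  | leaf s => simpa [Holding.start, TaskTree.sizes] using hd
  | node l r hl hr =>
    refine hl _ ht.2.2.1 ⟨ht.2.2.2, ht.1, ?_⟩
    simpa [TaskTree.sizes] using hd

/-- The topmost branch alone has about as many tasks as all that lies below it; this is how the
balance of the trees enters the bound with `M`. -/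
theorem BalancedDeque.of_append {c : ℕ} {d : List TaskTree} {t : TaskTree}
    (h : BalancedDeque c (d ++ [t])) :
    BalancedDeque c d ∧ t.Balanced ∧ c + dequeWeight (fun _ => 1) d ≤ t.sizes.length + 1 := by
  induction d generalizing c with
  | nil => exact ⟨trivial, h.1, by simpa using h.2.1⟩
  | cons u d ih =>
    obtain ⟨h1, h2, h3⟩ := h
    obtain ⟨h4, h5, h6⟩ := ih h3
    refine ⟨⟨h1, h2, h4⟩, h5, ?_⟩
    simp only [dequeWeight_cons, ← TaskTree.length_sizes]
    omega

/-! ### The invariants of a holding -/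

/-- The invariants of a holding: task sizes in `[1, L]`, balanced deque, rank at most `H`. -/
structure Holding.Good {P : ℕ} (L H : ℕ) (h : Holding P) : Prop where
  pos : 1 ≤ h.timeLeft
  le : h.timeLeft ≤ L
  sizes : ∀ u ∈ h.deque, ∀ s ∈ u.sizes, 1 ≤ s ∧ s ≤ L
  balanced : BalancedDeque 1 h.deque
  rank_le : rank h.deque ≤ H

theorem good_start {P L H : ℕ} (o : Fin P) (t : TaskTree) (ht : t.Balanced)
    (hs : ∀ s ∈ t.sizes, 1 ≤ s ∧ s ≤ L) (hh : t.height ≤ H) :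
    (Holding.start o t []).Good L H where
  pos := (hs _ (start_timeLeft_mem o t [])).1
  le := (hs _ (start_timeLeft_mem o t [])).2
  sizes := start_sizes (fun s => 1 ≤ s ∧ s ≤ L) o t [] hs (by simp)
  balanced := start_balanced o t [] ht trivial
  rank_le := (start_rank o t []).trans (by simpa [rank] using hh)

theorem Holding.Good.advance {P L H : ℕ} {h h' : Holding P} (hg : h.Good L H)
    (hh : h.advance = some h') : h'.Good L H := by
  unfold Holding.advance at hh
  split_ifs at hh with h1
  · cases hh
    exact ⟨by dsimp; omega, by have := hg.le; dsimp; omega, hg.sizes, hg.balanced, hg.rank_le⟩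
  · split at hh
    · cases hh
    · next t d hd =>
      cases hh
      have hs := hg.sizes
      have hb := hg.balanced
      have hr := hg.rank_le
      rw [hd] at hs hb hr
      simp only [rank] at hr
      refine ⟨(hs t (by simp) _ (start_timeLeft_mem _ t d)).1,
        (hs t (by simp) _ (start_timeLeft_mem _ t d)).2,
        start_sizes (fun s => 1 ≤ s ∧ s ≤ L) _ t d (hs t (by simp))
          (fun u hu => hs u (by simp [hu])),
        start_balanced _ t d hb.1 (hb.2.2.anti (by omega)), (start_rank _ t d).trans (by omega)⟩

theorem advance_owner {P : ℕ} {h h' : Holding P} (hh : h.advance = some h') :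
    h'.owner = h.owner := by
  unfold Holding.advance at hh
  split_ifs at hh with h1
  · cases hh; rfl
  · split at hh
    · cases hh
    · cases hh; exact start_owner _ _ _

theorem advance_deque_ne_nil {P : ℕ} {h h' : Holding P} (hh : h.advance = some h')
    (hd : h'.deque ≠ []) : h.deque ≠ [] := by
  unfold Holding.advance at hh
  split_ifs at hh with h1
  · cases hh; exact hd
  · split at hh
    · cases hh
    · next t d hd' => rw [hd']; simp

/-- The holding without the topmost branch of its deque. -/
def Holding.rest {P : ℕ} (h : Holding P) : Holding P := { h with deque := h.deque.dropLast }

/-- The topmost branch of a nonempty deque. -/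
def Holding.top {P : ℕ} (h : Holding P) : TaskTree := h.deque.getLastD (.leaf 0)

/-- What the thief of the topmost branch holds. -/
def Holding.loot {P : ℕ} (h : Holding P) : Holding P := Holding.start h.owner h.top []

theorem Holding.deque_eq {P : ℕ} {h : Holding P} (hd : h.deque ≠ []) :
    h.deque = h.rest.deque ++ [h.top] := by
  unfold Holding.rest Holding.top
  rw [List.getLastD_eq_getLast?, List.getLast?_eq_some_getLast hd]
  exact (List.dropLast_append_getLast hd).symm

theorem Holding.loot_owner {P : ℕ} (h : Holding P) : h.loot.owner = h.owner := start_owner _ _ _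

theorem Holding.Good.rest {P L H : ℕ} {h : Holding P} (hg : h.Good L H) (hd : h.deque ≠ []) :
    h.rest.Good L H := by
  have he := Holding.deque_eq hd
  have hb := hg.balanced
  have hr := hg.rank_le
  rw [he] at hb hr
  refine ⟨hg.pos, hg.le, fun u hu => hg.sizes u (by rw [he]; simp [hu]), hb.of_append.1, ?_⟩
  have := (rank_append_singleton h.rest.deque h.top).1
  omega

theorem Holding.Good.loot {P L H : ℕ} {h : Holding P} (hg : h.Good L H) (hd : h.deque ≠ []) :
    h.loot.Good L H := by
  have he := Holding.deque_eq hd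
  have hb := hg.balanced
  have hr := hg.rank_le
  rw [he] at hb hr
  refine good_start _ _ hb.of_append.2.1 (fun s hs => hg.sizes h.top (by rw [he]; simp) s hs) ?_
  have := (rank_append_singleton h.rest.deque h.top).2
  omega

variable {P : ℕ}

/-! ### One time step -/

/-- The winners are selected among the attempts that could succeed. -/
def ValidWinners (s : State P) (a : Attempts P) (w : Fin P → Fin P) : Prop :=
  ∀ j, (∃ i, Eligible s a i j) → Eligible s a (w j) j

/-- A branch of `j` is stolen. -/
def Hit (s : State P) (a : Attempts P) (w : Fin P → Fin P) (j : Fin P) : Prop :=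
  ∃ i, Succeeds s a w i j

theorem Hit.eligible {s : State P} {a : Attempts P} {w : Fin P → Fin P} {j : Fin P}
    (h : Hit s a w j) : Eligible s a (w j) j := by
  obtain ⟨i, hi, rfl⟩ := h
  exact hi

/-- One attempt that could succeed forces a theft, even if the rule prefers a competitor. This makes
the accounting independent of the rule. -/
theorem ValidWinners.hit {s : State P} {a : Attempts P} {w : Fin P → Fin P}
    (hw : ValidWinners s a w) {i j : Fin P} (h : Eligible s a i j) : Hit s a w j :=
  ⟨w j, hw j ⟨i, h⟩, rfl⟩

theorem attempt_mem_targets {s : State P} {a : Attempts P}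
    (ha : a ∈ Fintype.piFinset (options s)) {i j : Fin P} (h : a i = some j) : j ∈ targets s i := by
  have := Fintype.mem_piFinset.1 ha i
  rw [h, options] at this
  split_ifs at this with hn
  · simpa using this
  · simp at this

theorem holds_eq_none_of_attempt {s : State P} {a : Attempts P}
    (ha : a ∈ Fintype.piFinset (options s)) {i j : Fin P} (h : a i = some j) :
    s.holds i = none := by
  have := attempt_mem_targets ha h
  unfold targets at this
  split_ifs at this with h1 h2
  · simp at this
  all_goals simpa using h1

theorem Eligible.free {s : State P} {a : Attempts P}
    (ha : a ∈ Fintype.piFinset (options s)) {i j : Fin P} (h : Eligible s a i j) :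
    s.holds i = none := holds_eq_none_of_attempt ha h.1

theorem nextHolding_busy {s : State P} {a : Attempts P} {w : Fin P → Fin P} {p : Fin P}
    {h : Holding P} (hp : s.holds p = some h) [Decidable (Hit s a w p)] :
    nextHolding s a w p = if Hit s a w p then h.rest.advance else h.advance := by
  unfold nextHolding
  rw [hp]
  by_cases hh : Hit s a w p
  · rw [if_pos hh]; exact if_pos hh
  · rw [if_neg hh]; exact if_neg hh

theorem nextHolding_success {s : State P} {a : Attempts P} {w : Fin P → Fin P} {p j : Fin P}
    {h : Holding P} (hp : s.holds p = none) (hj : s.holds j = some h) (hs : Succeeds s a w p j) :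
    nextHolding s a w p = some h.loot := by
  obtain ⟨h', hj', hd, -⟩ := hs.1.2
  obtain rfl : h = h' := by rw [hj] at hj'; exact Option.some.inj hj'
  unfold nextHolding
  rw [hp]
  dsimp only
  rw [hs.1.1]
  dsimp only
  rw [if_pos hs, hj]
  dsimp only
  rw [Holding.loot, Holding.top, List.getLastD_eq_getLast?, List.getLast?_eq_some_getLast hd]
  rfl

theorem nextHolding_failure {s : State P} {a : Attempts P} {w : Fin P → Fin P} {p : Fin P}
    (hp : s.holds p = none) (hs : ∀ j, ¬ Succeeds s a w p j) :
    nextHolding s a w p = none := by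
  unfold nextHolding
  rw [hp]
  dsimp only
  split
  · rfl
  · rw [if_neg (hs _)]

theorem nextHolding_cases {s : State P} {a : Attempts P} {w : Fin P → Fin P} {p : Fin P}
    {h' : Holding P} (hn : nextHolding s a w p = some h') :
    (∃ h, s.holds p = some h ∧ ¬ Hit s a w p ∧ h.advance = some h') ∨
    (∃ h, s.holds p = some h ∧ Hit s a w p ∧ h.deque ≠ [] ∧ h.rest.advance = some h') ∨
    (∃ j h, s.holds p = none ∧ Succeeds s a w p j ∧ s.holds j = some h ∧ h.deque ≠ [] ∧
      h' = h.loot) := by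
  classical
  rcases hp : s.holds p with _ | h
  · right; right
    by_cases hs : ∃ j, Succeeds s a w p j
    · obtain ⟨j, hs⟩ := hs
      obtain ⟨h, hj, hd, -⟩ := hs.1.2
      rw [nextHolding_success hp hj hs] at hn
      exact ⟨j, h, rfl, hs, hj, hd, (Option.some.inj hn).symm⟩
    · push Not at hs
      rw [nextHolding_failure hp hs] at hn
      cases hn
  · rw [nextHolding_busy hp] at hn
    split_ifs at hn with hh
    · right; left
      obtain ⟨h2, hj, hd, -⟩ := hh.eligible.2
      rw [hp] at hj
      cases hj
      exact ⟨h, rfl, hh, hd, hn⟩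
    · left
      exact ⟨h, rfl, hh, hn⟩

/-- The sum of a quantity over all holdings. -/
def State.total {M : Type*} [AddCommMonoid M] (s : State P) (f : Fin P → Holding P → M) : M :=
  ∑ p, (s.holds p).elim 0 (f p)

theorem State.total_mono {M : Type*} [AddCommMonoid M] [PartialOrder M] [IsOrderedAddMonoid M]
    {s : State P} {f g : Fin P → Holding P → M}
    (h : ∀ p x, s.holds p = some x → f p x ≤ g p x) : s.total f ≤ s.total g := by
  refine Finset.sum_le_sum fun p _ => ?_
  rcases hp : s.holds p with _ | x
  · exact le_rfl
  · exact h p x hp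

/-- Bookkeeping by victims: the part that a thief takes is charged to the holding it came from.
Every potential that sums over holdings is then controlled by looking at one holding at a time. -/
theorem total_next {M : Type*} [AddCommMonoid M] {s : State P} {a : Attempts P}
    {w : Fin P → Fin P} (ha : a ∈ Fintype.piFinset (options s)) (f : Fin P → Holding P → M)
    [∀ j, Decidable (Hit s a w j)] :
    (s.next a w).total f = s.total fun j h =>
      if Hit s a w j then h.rest.advance.elim 0 (f j) + f (w j) h.loot
      else h.advance.elim 0 (f j) := by
  classical
  have key : ∀ p, (nextHolding s a w p).elim 0 (f p) =
      (s.holds p).elim 0 (fun h => if Hit s a w p then h.rest.advance.elim 0 (f p)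
        else h.advance.elim 0 (f p)) +
      ∑ j, if Succeeds s a w p j then (s.holds j).elim 0 (fun h => f p h.loot) else 0 := by
    intro p
    rcases hp : s.holds p with _ | h
    · by_cases hs : ∃ j, Succeeds s a w p j
      · obtain ⟨j, hs⟩ := hs
        obtain ⟨h, hj, hd, -⟩ := hs.1.2
        rw [nextHolding_success hp hj hs, Finset.sum_eq_single j]
        · simp [hs, hj]
        · intro j' _ hne
          rw [if_neg]
          intro hs'
          have := hs'.1.1
          rw [hs.1.1] at this
          exact hne (Option.some.inj this).symm
        · simp
      · push Not at hs
        rw [nextHolding_failure hp hs]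
        simp [hs]
    · have : ∀ j, ¬ Succeeds s a w p j := fun j hs => by
        have := hs.1.free ha
        rw [hp] at this
        cases this
      rw [nextHolding_busy hp]
      simp only [this, if_false, Finset.sum_const_zero, add_zero, Option.elim_some]
      split_ifs <;> rfl
  unfold State.total
  simp only [State.next, key]
  rw [Finset.sum_add_distrib, Finset.sum_comm, ← Finset.sum_add_distrib]
  refine Finset.sum_congr rfl fun j _ => ?_
  rcases hj : s.holds j with _ | h
  · simp
  · simp only [Option.elim_some]
    split_ifs with hh
    · congr 1
      rw [Finset.sum_eq_single (w j)]
      · rw [if_pos ⟨hh.eligible, rfl⟩]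
      · intro p _ hne
        rw [if_neg]
        exact fun hs => hne hs.2.symm
      · simp
    · rw [Finset.sum_eq_zero, add_zero]
      intro p _
      rw [if_neg]
      exact fun hs => hh ⟨p, hs⟩

theorem total_next_le {M : Type*} [AddCommMonoid M] [PartialOrder M] [IsOrderedAddMonoid M]
    {s : State P} {a : Attempts P}
    {w : Fin P → Fin P} (ha : a ∈ Fintype.piFinset (options s)) {f g : Fin P → Holding P → M}
    (h1 : ∀ j h, s.holds j = some h → ¬ Hit s a w j → h.advance.elim 0 (f j) ≤ g j h)
    (h2 : ∀ j h, s.holds j = some h → Hit s a w j → h.deque ≠ [] →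
      h.rest.advance.elim 0 (f j) + f (w j) h.loot ≤ g j h) :
    (s.next a w).total f ≤ s.total g := by
  classical
  rw [total_next ha]
  refine State.total_mono fun p x hp => ?_
  split_ifs with hh
  · obtain ⟨y, hy, hd, -⟩ := hh.eligible.2
    obtain rfl : x = y := by rw [hp] at hy; exact Option.some.inj hy
    exact h2 p x hp hh hd
  · exact h1 p x hp hh

/-! ### Invariants of the execution -/

/-- The invariants of a state: good holdings, and every processor that works for another owner and has
a branch that can be stolen is on the list of the owner. -/
structure State.Good (L H : ℕ) (s : State P) : Prop where
  holding : ∀ p h, s.holds p = some h → h.Good L H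
  listed : ∀ p h, s.holds p = some h → h.deque ≠ [] → p ≠ h.owner → p ∈ s.helpers h.owner

/-- For the lists: a helper is only removed if nothing could be taken from it, and without a new
theft its deque cannot become nonempty again. -/
theorem State.Good.next {L H : ℕ} {s : State P} (hg : s.Good L H) {a : Attempts P}
    {w : Fin P → Fin P} : (s.next a w).Good L H where
  holding p h' hp := by
    rcases nextHolding_cases hp with ⟨h, hh, -, ha⟩ | ⟨h, hh, -, hd, ha⟩ | ⟨j, h, -, -, hj, hd, rfl⟩
    · exact (hg.holding p h hh).advance ha
    · exact ((hg.holding p h hh).rest hd).advance ha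
    · exact (hg.holding j h hj).loot hd
  listed p h' hp hd' hne := by
    classical
    have old : ∀ h, s.holds p = some h → h.deque ≠ [] → h'.owner = h.owner →
        p ∈ nextHelpers s a w h'.owner := by
      intro h hh hd ho
      rw [ho] at hne ⊢
      refine Finset.mem_union_left _ (Finset.mem_filter.2 ⟨hg.listed p h hh hd hne, ?_⟩)
      rintro ⟨h1, h2⟩
      exact h2 ⟨h1, h, hh, hd, fun _ => rfl⟩
    rcases nextHolding_cases hp with ⟨h, hh, -, ha⟩ | ⟨h, hh, -, hd, ha⟩ | ⟨j, h, hf, hs, hj, hd, rfl⟩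
    · exact old h hh (advance_deque_ne_nil ha hd') (advance_owner ha)
    · exact old h hh hd (show h'.owner = h.rest.owner from advance_owner ha)
    · rw [h.loot_owner] at hne ⊢
      refine Finset.mem_union_right _ (Finset.mem_filter.2 ⟨Finset.mem_univ _, hne, ?_, j, h, hs, hj, rfl⟩)
      -- A thief with a nonempty list makes a steal-back and only takes its own work, so the thief
      -- of foreign work has an empty list and gets listed.
      by_contra hl
      obtain ⟨y, hy, -, ho⟩ := hs.1.2
      rw [hj] at hy
      cases hy
      exact hne (ho (Finset.nonempty_iff_ne_empty.2 hl)).symm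

theorem finished_next {s : State P} (hf : s.Finished) (a : Attempts P) (w : Fin P → Fin P) :
    (s.next a w).Finished := by
  intro p
  refine nextHolding_failure (hf p) fun j hs => ?_
  obtain ⟨h, hj, -⟩ := hs.1.2
  rw [hf j] at hj
  cases hj

/-- The busy processors. -/
def busy (s : State P) : Finset (Fin P) := Finset.univ.filter fun j => (s.holds j).isSome

/-- The free processors with an empty list, which make general steals. -/
def general (s : State P) : Finset (Fin P) :=
  Finset.univ.filter fun i => s.holds i = none ∧ s.helpers i = ∅

/-- The free processors with a nonempty list, which make steal-backs. -/
def backers (s : State P) : Finset (Fin P) :=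
  Finset.univ.filter fun i => s.holds i = none ∧ (s.helpers i).Nonempty

theorem card_busy_add (s : State P) :
    (busy s).card + (general s).card + (backers s).card = P := by
  classical
  have h1 : Disjoint (busy s) (general s) := by
    rw [Finset.disjoint_left]
    intro i hi hj
    simp only [busy, general, Finset.mem_filter, Finset.mem_univ, true_and] at hi hj
    rw [hj.1] at hi
    cases hi
  have h2 : Disjoint (busy s ∪ general s) (backers s) := by
    rw [Finset.disjoint_left]
    intro i hi hj
    simp only [busy, general, backers, Finset.mem_union, Finset.mem_filter, Finset.mem_univ,
      true_and] at hi hj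
    rcases hi with hi | hi
    · rw [hj.1] at hi; cases hi
    · exact hj.2.ne_empty hi.2
  rw [← Finset.card_union_of_disjoint h1, ← Finset.card_union_of_disjoint h2]
  conv_rhs => rw [← Fintype.card_fin P, ← Finset.card_univ]
  congr 1
  ext i
  simp only [busy, general, backers, Finset.mem_union, Finset.mem_filter, Finset.mem_univ, true_and,
    iff_true]
  rcases hi : s.holds i with _ | h
  · rcases (s.helpers i).eq_empty_or_nonempty with he | he <;> simp [he]
  · simp

theorem busy_nonempty {s : State P} (hf : ¬ s.Finished) : (busy s).Nonempty := by
  unfold State.Finished at hf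
  push Not at hf
  obtain ⟨i, hi⟩ := hf
  exact ⟨i, by simpa [busy, Option.isSome_iff_ne_none] using hi⟩

theorem mem_busy {s : State P} {j : Fin P} : j ∈ busy s ↔ ∃ h, s.holds j = some h := by
  simp [busy, Option.isSome_iff_exists]

theorem options_general {s : State P} {i : Fin P} (hi : i ∈ general s) (hb : (busy s).Nonempty) :
    options s i = (busy s).image some := by
  simp only [general, Finset.mem_filter, Finset.mem_univ, true_and] at hi
  have : targets s i = busy s := by
    simp [targets, hi.1, hi.2, busy]
  rw [options, this, if_pos hb]

theorem options_backers {s : State P} {i : Fin P} (hi : i ∈ backers s) :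
    options s i = (s.helpers i).image some := by
  simp only [backers, Finset.mem_filter, Finset.mem_univ, true_and] at hi
  have : targets s i = s.helpers i := by
    simp [targets, hi.1, hi.2]
  rw [options, this, if_pos hi.2]

/-! ### Averages over a product of finite sets -/

section Average

variable {ι α : Type*} [Fintype ι] [DecidableEq ι]

/-- The average of a function over a product of finite sets. -/
noncomputable def piAvg (t : ι → Finset α) (f : (ι → α) → ℝ) : ℝ :=
  (∑ p ∈ Fintype.piFinset t, f p) / (Fintype.piFinset t).card

variable {t : ι → Finset α}

/-- This is the independence of the choices; every probability computed below is a special case for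
suitable factors. -/
theorem piAvg_prod (φ : ι → α → ℝ) :
    piAvg t (fun p => ∏ i, φ i (p i)) = ∏ i, (∑ x ∈ t i, φ i x) / (t i).card := by
  rw [piAvg, Finset.prod_div_distrib, Finset.prod_univ_sum, Fintype.card_piFinset, Nat.cast_prod]

theorem card_piFinset_pos (ht : ∀ i, (t i).Nonempty) : (0 : ℝ) < (Fintype.piFinset t).card := by
  exact_mod_cast Finset.card_pos.2 (Fintype.piFinset_nonempty.2 ht)

theorem piAvg_const (ht : ∀ i, (t i).Nonempty) (c : ℝ) : piAvg t (fun _ => c) = c := by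
  rw [piAvg, Finset.sum_const, nsmul_eq_mul, mul_div_cancel_left₀ _ (card_piFinset_pos ht).ne']

theorem piAvg_add (f g : (ι → α) → ℝ) :
    piAvg t (fun p => f p + g p) = piAvg t f + piAvg t g := by
  simp only [piAvg, Finset.sum_add_distrib, add_div]

theorem piAvg_sub (f g : (ι → α) → ℝ) :
    piAvg t (fun p => f p - g p) = piAvg t f - piAvg t g := by
  simp only [piAvg, Finset.sum_sub_distrib, sub_div]

theorem piAvg_const_mul (c : ℝ) (f : (ι → α) → ℝ) :
    piAvg t (fun p => c * f p) = c * piAvg t f := by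
  simp only [piAvg, ← Finset.mul_sum, mul_div_assoc]

theorem piAvg_sum {κ : Type*} (s : Finset κ) (f : κ → (ι → α) → ℝ) :
    piAvg t (fun p => ∑ k ∈ s, f k p) = ∑ k ∈ s, piAvg t (f k) := by
  simp only [piAvg, ← Finset.sum_div]
  rw [Finset.sum_comm]

theorem piAvg_mono {f g : (ι → α) → ℝ} (h : ∀ p ∈ Fintype.piFinset t, f p ≤ g p) :
    piAvg t f ≤ piAvg t g :=
  div_le_div_of_nonneg_right (Finset.sum_le_sum h) (Nat.cast_nonneg _)

theorem piAvg_single (ht : ∀ i, (t i).Nonempty) (i : ι) (f : α → ℝ) :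
    piAvg t (fun p => f (p i)) = (∑ x ∈ t i, f x) / (t i).card := by
  have h := piAvg_prod (t := t) (fun k x => if k = i then f x else 1)
  have h1 : ∀ p : ι → α, (∏ k, if k = i then f (p k) else 1) = f (p i) := fun p => by
    rw [Finset.prod_ite_eq' Finset.univ i fun k => f (p k)]
    simp
  simp only [h1] at h
  rw [h, Finset.prod_eq_single i]
  · simp
  · intro k _ hk
    simp only [hk, if_false, Finset.sum_const, nsmul_eq_mul, mul_one]
    exact div_self (Nat.cast_ne_zero.2 (Finset.card_pos.2 (ht k)).ne')
  · simp

theorem piAvg_pair (ht : ∀ i, (t i).Nonempty) {i j : ι} (hij : i ≠ j) (f g : α → ℝ) :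
    piAvg t (fun p => f (p i) * g (p j)) =
      ((∑ x ∈ t i, f x) / (t i).card) * ((∑ x ∈ t j, g x) / (t j).card) := by
  have h := piAvg_prod (t := t) (fun k x => if k = i then f x else if k = j then g x else 1)
  have h1 : ∀ F : ι → ℝ, (∀ k, k ≠ i → k ≠ j → F k = 1) → ∏ k, F k = F i * F j := fun F hF => by
    rw [← Finset.prod_pair hij]
    symm
    refine Finset.prod_subset (Finset.subset_univ _) fun k _ hk => ?_
    simp only [Finset.mem_insert, Finset.mem_singleton, not_or] at hk
    exact hF k hk.1 hk.2
  rw [h1] at h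
  · simp only [if_true, hij.symm, if_false] at h
    rw [← h]
    congr 1
    funext p
    rw [h1]
    · simp [hij.symm]
    · intro k hi hj; simp [hi, hj]
  · intro k hi hj
    simp only [hi, hj, if_false, Finset.sum_const, nsmul_eq_mul, mul_one]
    exact div_self (Nat.cast_ne_zero.2 (Finset.card_pos.2 (ht k)).ne')

theorem piAvg_avoid [DecidableEq α] (ht : ∀ i, (t i).Nonempty) (G : Finset ι) (x : α)
    (hx : ∀ i ∈ G, x ∈ t i) :
    piAvg t (fun p => if ∃ i ∈ G, p i = x then (0 : ℝ) else 1) =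
      ∏ i ∈ G, (1 - 1 / ((t i).card : ℝ)) := by
  have h := piAvg_prod (t := t) (fun k y => if k ∈ G then (if y = x then 0 else 1) else 1)
  have h1 : ∀ p : ι → α, (∏ k, if k ∈ G then (if p k = x then (0 : ℝ) else 1) else 1) =
      if ∃ i ∈ G, p i = x then (0 : ℝ) else 1 := fun p => by
    split_ifs with hp
    · obtain ⟨i, hi, he⟩ := hp
      exact Finset.prod_eq_zero (Finset.mem_univ i) (by simp [hi, he])
    · push Not at hp
      refine Finset.prod_eq_one fun k _ => ?_
      split_ifs with h2 h3
      · exact absurd h3 (hp k h2)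
      · rfl
      · rfl
  simp only [h1] at h
  rw [h, ← Finset.prod_subset (Finset.subset_univ G)]
  · refine Finset.prod_congr rfl fun i hi => ?_
    have hc : ((t i).card : ℝ) ≠ 0 := Nat.cast_ne_zero.2 (Finset.card_pos.2 (ht i)).ne'
    simp only [hi, if_true]
    rw [Finset.sum_ite, Finset.sum_const_zero, zero_add, Finset.sum_const, nsmul_eq_mul, mul_one,
      Finset.filter_ne', Finset.card_erase_of_mem (hx i hi),
      Nat.cast_sub (Finset.card_pos.2 (ht i)), sub_div, div_self hc, Nat.cast_one]
  · intro k _ hk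
    simp only [hk, if_false, Finset.sum_const, nsmul_eq_mul, mul_one]
    exact div_self (Nat.cast_ne_zero.2 (Finset.card_pos.2 (ht k)).ne')

end Average

/-! ### Averages over the attempts of a time step -/

/-- The expectation over the attempts of a time step. -/
noncomputable abbrev avg (s : State P) (f : Attempts P → ℝ) : ℝ := piAvg (options s) f

theorem avg_general {s : State P} (hb : (busy s).Nonempty) {i j : Fin P} (hi : i ∈ general s)
    (hj : j ∈ busy s) :
    avg s (fun a => if a i = some j then (1 : ℝ) else 0) = 1 / (busy s).card := by
  rw [avg, piAvg_single (options_nonempty s) i fun x => if x = some j then (1 : ℝ) else 0,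
    options_general hi hb, Finset.card_image_of_injective _ (Option.some_injective _),
    Finset.sum_image (fun _ _ _ _ h => Option.some_injective _ h)]
  congr 1
  simp [hj]

theorem avg_backer {s : State P} {i : Fin P} (hi : i ∈ backers s) (f : Option (Fin P) → ℝ) :
    avg s (fun a => f (a i)) = (∑ j ∈ s.helpers i, f (some j)) / (s.helpers i).card := by
  rw [avg, piAvg_single (options_nonempty s) i f, options_backers hi,
    Finset.card_image_of_injective _ (Option.some_injective _),
    Finset.sum_image (fun _ _ _ _ h => Option.some_injective _ h)]

theorem avg_backer_general {s : State P} (hb : (busy s).Nonempty) {i k j : Fin P}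
    (hi : i ∈ backers s) (hk : k ∈ general s) (hj : j ∈ busy s) (f : Option (Fin P) → ℝ) :
    avg s (fun a => f (a i) * if a k = some j then (1 : ℝ) else 0) =
      (∑ j ∈ s.helpers i, f (some j)) / (s.helpers i).card * (1 / (busy s).card) := by
  have hne : i ≠ k := by
    rintro rfl
    simp only [backers, general, Finset.mem_filter, Finset.mem_univ, true_and] at hi hk
    exact hi.2.ne_empty hk.2
  rw [← avg_backer hi f, ← avg_general hb hk hj, avg, avg, avg,
    piAvg_pair (options_nonempty s) hne f fun x => if x = some j then (1 : ℝ) else 0,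
    piAvg_single (options_nonempty s) i f,
    piAvg_single (options_nonempty s) k fun x => if x = some j then (1 : ℝ) else 0]

/-- Since `(1 - x) ^ n * (1 + x) ^ n ≤ 1`, Bernoulli gives `(1 - x) ^ n ≤ 1 / (1 + n * x)`, and `1 /
(1 + y) ≤ 1 - y / 2` on `[0, 1]`. -/
theorem one_sub_pow_le {x : ℝ} (h0 : 0 ≤ x) (h1 : x ≤ 1) (n : ℕ) (hn : n * x ≤ 1) :
    (1 - x) ^ n ≤ 1 - n * x / 2 := by
  have hb : 1 + n * x ≤ (1 + x) ^ n := one_add_mul_le_pow (by linarith) n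
  have h2 : (1 - x) ^ n * (1 + x) ^ n ≤ 1 := by
    rw [← mul_pow]
    exact pow_le_one₀ (by nlinarith) (by nlinarith)
  have h3 : 0 ≤ (1 - x) ^ n := pow_nonneg (by linarith) n
  have h4 : 0 ≤ n * x := by positivity
  have h5 : (1 - x) ^ n * (1 + n * x) ≤ 1 := (mul_le_mul_of_nonneg_left hb h3).trans h2
  nlinarith

/-- The probability that `j` is attacked by some general thief. Steal-back attempts are ignored,
since they need not be eligible. -/
theorem avg_hit_ge {s : State P} {j : Fin P} (hj : j ∈ busy s) :
    ((general s).card : ℝ) / (2 * P) ≤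
      avg s (fun a => if ∃ k ∈ general s, a k = some j then (1 : ℝ) else 0) := by
  have hb : (busy s).Nonempty := ⟨j, hj⟩
  have hB : (1 : ℝ) ≤ (busy s).card := by exact_mod_cast Finset.card_pos.2 hb
  have hsum := card_busy_add s
  have hBP : ((busy s).card : ℝ) ≤ P := by exact_mod_cast (by omega : (busy s).card ≤ P)
  have hgP : ((general s).card : ℝ) ≤ P := by exact_mod_cast (by omega : (general s).card ≤ P)
  have hP : (0 : ℝ) < P := by linarith
  have h1 := piAvg_avoid (options_nonempty s) (general s) (some j) (fun i hi => by
    rw [options_general hi hb]; exact Finset.mem_image_of_mem _ hj)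
  have h2 : ∀ i ∈ general s, (1 - 1 / ((options s i).card : ℝ)) = 1 - 1 / (busy s).card := by
    intro i hi
    rw [options_general hi hb, Finset.card_image_of_injective _ (Option.some_injective _)]
  rw [Finset.prod_congr rfl h2, Finset.prod_const] at h1
  have h3 : avg s (fun a => if ∃ k ∈ general s, a k = some j then (1 : ℝ) else 0) =
      1 - (1 - 1 / ((busy s).card : ℝ)) ^ (general s).card := by
    rw [← h1]
    conv_rhs => enter [1]; rw [← piAvg_const (options_nonempty s) 1]
    rw [← piAvg_sub]
    congr 1
    funext a
    split_ifs <;> simp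
  rw [h3]
  -- Fewer busy processors only concentrate the attacks. With `P` in place of their number, the
  -- product in `one_sub_pow_le` is at most 1.
  have h4 : (1 - 1 / ((busy s).card : ℝ)) ^ (general s).card ≤
      (1 - 1 / (P : ℝ)) ^ (general s).card := by
    refine pow_le_pow_left₀ ?_ ?_ _
    · rw [sub_nonneg, div_le_one (by linarith)]; exact hB
    · have := one_div_le_one_div_of_le (by linarith : (0 : ℝ) < (busy s).card) hBP
      linarith
  have h5 := one_sub_pow_le (x := 1 / (P : ℝ)) (by positivity)
    (by rw [div_le_one hP]; linarith) (general s).card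
    (by rw [mul_one_div, div_le_one hP]; exact hgP)
  have h6 : ((general s).card : ℝ) * (1 / P) / 2 = (general s).card / (2 * P) := by
    field_simp
  linarith

/-! ### Expectations under a probability mass function -/

section Expectation

variable {α β : Type*}

/-- The expectation of a nonnegative function. -/
noncomputable def expect (p : PMF α) (g : α → ENNReal) : ENNReal := ∑' x, p x * g x

theorem expect_pure (x : α) (g : α → ENNReal) : expect (PMF.pure x) g = g x := by
  rw [expect, tsum_eq_single x]
  · simp
  · intro y hy
    simp [PMF.pure_apply, hy]

theorem expect_bind (p : PMF α) (f : α → PMF β) (g : β → ENNReal) :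
    expect (p.bind f) g = expect p fun x => expect (f x) g := by
  simp only [expect, PMF.bind_apply, ← ENNReal.tsum_mul_right, ← ENNReal.tsum_mul_left]
  rw [ENNReal.tsum_comm]
  simp only [mul_assoc]

theorem expect_map (p : PMF α) (f : α → β) (g : β → ENNReal) :
    expect (p.map f) g = expect p fun x => g (f x) := by
  rw [PMF.map, expect_bind]
  simp only [Function.comp, expect_pure]

theorem expect_mono_support (p : PMF α) {f g : α → ENNReal} (h : ∀ x ∈ p.support, f x ≤ g x) :
    expect p f ≤ expect p g := by
  refine ENNReal.tsum_le_tsum fun x => ?_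
  by_cases hx : p x = 0
  · simp [hx]
  · exact mul_le_mul_right (h x ((PMF.mem_support_iff p x).2 hx)) _

theorem expect_const (p : PMF α) (c : ENNReal) : expect p (fun _ => c) = c := by
  rw [expect, ENNReal.tsum_mul_right, p.tsum_coe, one_mul]

theorem expect_add (p : PMF α) (f g : α → ENNReal) :
    expect p (fun x => f x + g x) = expect p f + expect p g := by
  simp only [expect, mul_add, ENNReal.tsum_add]

open Classical in
theorem expect_indicator (p : PMF α) (s : Set α) :
    expect p (fun x => if x ∈ s then 1 else 0) = p.toOuterMeasure s := by
  rw [PMF.toOuterMeasure_apply, expect]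
  congr 1
  funext x
  by_cases hx : x ∈ s <;> simp [hx]

end Expectation

/-! ### Additive drift for the execution -/

theorem expect_attemptLaw (s : State P) (f : Attempts P → ℝ)
    (hf : ∀ a ∈ Fintype.piFinset (options s), 0 ≤ f a) :
    expect (attemptLaw s) (fun a => ENNReal.ofReal (f a)) = ENNReal.ofReal (avg s f) := by
  have hc := card_piFinset_pos (options_nonempty s)
  rw [expect, tsum_eq_sum (s := Fintype.piFinset (options s))]
  · rw [avg, piAvg, div_eq_inv_mul, ENNReal.ofReal_mul (by positivity), ENNReal.ofReal_inv_of_pos hc,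
      ENNReal.ofReal_natCast, ENNReal.ofReal_sum_of_nonneg hf, Finset.mul_sum]
    refine Finset.sum_congr rfl fun a ha => ?_
    rw [attemptLaw, PMF.uniformOfFinset_apply_of_mem _ ha]
  · intro a ha
    rw [attemptLaw, PMF.uniformOfFinset_apply_of_notMem _ ha, zero_mul]

theorem mem_support_attemptLaw {s : State P} {a : Attempts P} :
    a ∈ (attemptLaw s).support ↔ a ∈ Fintype.piFinset (options s) := by
  rw [attemptLaw, PMF.mem_support_uniformOfFinset_iff]

/-- The additive drift theorem for the execution: a potential that decreases on average by `c` in each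
time step before the end bounds the expected execution time. -/
theorem expectedTime_le_of_drift (σ : ContentionRule P) (W : Workload P) (Inv : State P → Prop)
    (V : State P → ℝ) {c : ℝ} (hc : 0 < c) (hV : ∀ s, Inv s → 0 ≤ V s)
    (h0 : Inv (State.initial W))
    (hstep : ∀ s a w, Inv s → a ∈ Fintype.piFinset (options s) → ValidWinners s a w →
      Inv (s.next a w))
    (hdrift : ∀ s, Inv s → ¬ s.Finished → ∃ U : Attempts P → ℝ,
      (∀ a ∈ Fintype.piFinset (options s), ∀ w, ValidWinners s a w → V (s.next a w) ≤ U a) ∧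
      avg s U ≤ V s - c) :
    expectedTime σ W ≤ ENNReal.ofReal (V (State.initial W) / c) := by
  classical
  -- Finished states get the value 0: the drift is only assumed before the end, and finished states
  -- stay finished.
  set v : History P × State P → ENNReal :=
    fun x => if x.2.Finished then 0 else ENNReal.ofReal (V x.2 / c) with hv
  have hinv : ∀ t, ∀ x ∈ (run σ W t).support, Inv x.2 := by
    intro t
    induction t with
    | zero =>
      intro x hx
      rw [run, PMF.support_pure, Set.mem_singleton_iff] at hx
      subst hx
      exact h0
    | succ t ih =>
      intro x hx
      rw [run, PMF.mem_support_bind_iff] at hx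
      obtain ⟨y, hy, hx⟩ := hx
      rw [PMF.mem_support_bind_iff] at hx
      obtain ⟨a, ha, hx⟩ := hx
      rw [PMF.mem_support_map_iff] at hx
      obtain ⟨w, hw, rfl⟩ := hx
      exact hstep _ _ _ (ih y hy) (mem_support_attemptLaw.1 ha) (σ.valid _ _ _ w hw)
  have hone : ∀ t, (run σ W t).toOuterMeasure {x | ¬ x.2.Finished} + expect (run σ W (t + 1)) v ≤
      expect (run σ W t) v := by
    intro t
    rw [← expect_indicator, run, expect_bind, ← expect_add]
    refine expect_mono_support _ fun x hx => ?_
    rw [expect_bind]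
    simp only [expect_map]
    by_cases hf : x.2.Finished
    · have : ∀ a w, v ((x.2, a) :: x.1, x.2.next a w) = 0 := fun a w =>
        if_pos (finished_next hf a w)
      simp [this, hf, expect_const]
    · obtain ⟨U, hU, hUavg⟩ := hdrift x.2 (hinv t x hx) hf
      -- `U a` dominates the potential of some possible successor. Nonnegativity is needed to pass
      -- through `ENNReal.ofReal`.
      have hU0 : ∀ a ∈ Fintype.piFinset (options x.2), 0 ≤ U a := by
        intro a ha
        obtain ⟨w, hw⟩ := (σ.select x.1 x.2 a).support_nonempty
        have hval : ValidWinners x.2 a w := σ.valid _ _ _ w hw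
        exact (hV _ (hstep _ _ _ (hinv t x hx) ha hval)).trans (hU a ha w hval)
      have h1 : (expect (attemptLaw x.2) fun a => expect (σ.select x.1 x.2 a) fun w =>
          v ((x.2, a) :: x.1, x.2.next a w)) ≤ ENNReal.ofReal (avg x.2 U / c) := by
        have h2 : avg x.2 U / c = avg x.2 (fun a => U a / c) := by
          simp only [div_eq_inv_mul]
          exact (piAvg_const_mul _ _).symm
        rw [h2, ← expect_attemptLaw _ _ fun a ha => div_nonneg (hU0 a ha) hc.le]
        refine expect_mono_support _ fun a ha => ?_
        rw [mem_support_attemptLaw] at ha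
        rw [← expect_const (σ.select x.1 x.2 a) (ENNReal.ofReal (U a / c))]
        refine expect_mono_support _ fun w hw => ?_
        simp only [hv]
        split_ifs with h3
        · exact zero_le
        · exact ENNReal.ofReal_le_ofReal
            (div_le_div_of_nonneg_right (hU a ha w (σ.valid _ _ _ w hw)) hc.le)
      have h3 : v x = ENNReal.ofReal (V x.2 / c) := if_neg hf
      rw [h3, if_pos (by exact hf)]
      have hA : 0 ≤ avg x.2 U := by
        rw [← piAvg_const (options_nonempty x.2) 0]
        exact piAvg_mono hU0
      calc (1 : ENNReal) + _ ≤ 1 + ENNReal.ofReal (avg x.2 U / c) := by gcongr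
        _ = ENNReal.ofReal (1 + avg x.2 U / c) := by
          rw [ENNReal.ofReal_add zero_le_one (div_nonneg hA hc.le), ENNReal.ofReal_one]
        _ ≤ _ := by
          refine ENNReal.ofReal_le_ofReal ?_
          rw [le_div_iff₀ hc, add_mul, div_mul_cancel₀ _ hc.ne']
          linarith
  have hsum : ∀ n, ∑ t ∈ Finset.range n, (run σ W t).toOuterMeasure {x | ¬ x.2.Finished} +
      expect (run σ W n) v ≤ v ([], State.initial W) := by
    intro n
    induction n with
    | zero => simp [run, expect_pure]
    | succ n ih =>
      rw [Finset.sum_range_succ, add_assoc]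
      exact (add_le_add le_rfl (hone n)).trans ih
  have hv0 : v ([], State.initial W) ≤ ENNReal.ofReal (V (State.initial W) / c) := by
    simp only [hv]
    split_ifs
    · exact zero_le
    · exact le_rfl
  rw [expectedTime, ENNReal.tsum_eq_iSup_nat]
  exact iSup_le fun n => (le_self_add.trans (hsum n)).trans hv0

/-! ### The volume of a holding -/

/-- The remaining work of a holding. -/
def Holding.volume (h : Holding P) : ℕ := h.timeLeft + dequeWeight (fun s => s) h.deque

theorem advance_volume {h : Holding P} (hp : 1 ≤ h.timeLeft) :
    h.advance.elim 0 Holding.volume + 1 = h.volume := by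
  unfold Holding.advance
  split_ifs with h1
  · simp only [Option.elim_some, Holding.volume]; omega
  · split
    · next hd => simp [Holding.volume, hd]; omega
    · next t d hd =>
      have := start_weight (fun s => s) h.owner t d
      simp only [Option.elim_some, Holding.volume, hd, dequeWeight_cons]
      omega

theorem loot_volume (h : Holding P) : h.loot.volume = h.top.weight fun s => s := by
  have := start_weight (fun s => s) h.owner h.top []
  simpa [Holding.volume, Holding.loot] using this

theorem rest_volume {h : Holding P} (hd : h.deque ≠ []) :
    h.rest.volume + h.loot.volume = h.volume := by
  rw [loot_volume]
  unfold Holding.volume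
  conv_rhs => rw [Holding.deque_eq hd]
  simp [Holding.rest]
  omega

/-- The remaining work. -/
noncomputable def State.volume (s : State P) : ℝ := s.total fun _ h => (h.volume : ℝ)

theorem total_one (s : State P) : (s.total fun _ _ => (1 : ℝ)) = (busy s).card := by
  classical
  rw [busy, Finset.card_filter, Nat.cast_sum]
  refine Finset.sum_congr rfl fun p _ => ?_
  rcases s.holds p with _ | h <;> simp

theorem State.total_nonneg {s : State P} {f : Fin P → Holding P → ℝ}
    (h : ∀ p x, s.holds p = some x → 0 ≤ f p x) : 0 ≤ s.total f := by
  refine Finset.sum_nonneg fun p _ => ?_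
  rcases hp : s.holds p with _ | x
  · exact le_rfl
  · exact h p x hp

theorem State.total_sub (s : State P) (f g : Fin P → Holding P → ℝ) :
    (s.total fun p h => f p h - g p h) = s.total f - s.total g := by
  unfold State.total
  rw [← Finset.sum_sub_distrib]
  refine Finset.sum_congr rfl fun p _ => ?_
  rcases s.holds p with _ | h <;> simp

theorem elim_cast (x : Option (Holding P)) (f : Holding P → ℕ) :
    x.elim (0 : ℝ) (fun h => (f h : ℝ)) = ((x.elim 0 f : ℕ) : ℝ) := by
  cases x <;> simp

theorem volume_next_le {L H : ℕ} {s : State P} (hg : s.Good L H) {a : Attempts P}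
    {w : Fin P → Fin P} (ha : a ∈ Fintype.piFinset (options s)) :
    (s.next a w).volume ≤ s.volume - (busy s).card := by
  rw [← total_one, State.volume, State.volume, ← State.total_sub]
  refine total_next_le ha ?_ ?_
  · intro j h hj _
    have := advance_volume (hg.holding j h hj).pos
    rw [elim_cast, ← this]
    push_cast
    linarith
  · intro j h hj _ hd
    have h1 := advance_volume (h := h.rest) (hg.holding j h hj).pos
    have h2 := rest_volume hd
    rw [elim_cast, ← h2, ← h1]
    push_cast
    linarith

/-! ### The potential of the general steals -/

/-- The potential of a holding: exponential in the number of time steps and steals that it can last. -/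
noncomputable def Holding.potential (L : ℕ) (h : Holding P) : ℝ :=
  if h.deque = [] then 3 ^ h.timeLeft else 3 ^ (rank h.deque + L)

theorem Holding.one_le_potential (L : ℕ) (h : Holding P) : 1 ≤ h.potential L := by
  unfold Holding.potential
  split_ifs <;> exact one_le_pow₀ (by norm_num)

theorem start_potential_le {L : ℕ} (o : Fin P) (t : TaskTree) (d : List TaskTree)
    (ht : ∀ s ∈ t.sizes, s ≤ L) :
    (Holding.start o t d).potential L ≤ 3 ^ (max (t.height + d.length) (rank d) + L) := by
  unfold Holding.potential
  split_ifs
  · exact pow_le_pow_right₀ (by norm_num) ((ht _ (start_timeLeft_mem o t d)).trans (by omega))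
  · exact pow_le_pow_right₀ (by norm_num) (Nat.add_le_add_right (start_rank o t d) _)

theorem advance_potential_le {L H : ℕ} {h : Holding P} (hg : h.Good L H) :
    h.advance.elim 0 (Holding.potential L) ≤ h.potential L := by
  unfold Holding.advance
  split_ifs with h1
  · simp only [Option.elim_some, Holding.potential]
    split_ifs
    · exact pow_le_pow_right₀ (by norm_num) (by omega)
    · exact le_rfl
  · split
    · have := h.one_le_potential L
      simp only [Option.elim_none]
      linarith
    · next t d hd =>
      simp only [Option.elim_some]
      refine (start_potential_le _ t d fun s hs => (hg.sizes t (by simp [hd]) s hs).2).trans ?_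
      simp only [Holding.potential, hd, rank, reduceCtorEq, if_false]
      exact pow_le_pow_right₀ (by norm_num) (by omega)

/-- One step even divides the power by 3 or ends it; the factor `2 / 3` is the one that a theft
achieves as well. -/
theorem advance_potential_le_of_nil {L : ℕ} {h : Holding P} (hd : h.deque = []) :
    h.advance.elim 0 (Holding.potential L) ≤ h.potential L * (2 / 3) := by
  unfold Holding.advance
  split_ifs with h1
  · simp only [Option.elim_some, Holding.potential, hd, if_true]
    obtain ⟨n, hn⟩ : ∃ n, h.timeLeft = n + 1 := ⟨h.timeLeft - 1, by omega⟩
    have : (0 : ℝ) < 3 ^ n := by positivity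
    rw [hn, Nat.add_sub_cancel, pow_succ]
    linarith
  · rw [hd]
    have := h.one_le_potential L
    simp only [Option.elim_none]
    linarith

/-- Both parts have a smaller rank, or an empty deque and a task of size at most `L`; either way
each keeps at most a third. Base 3 makes the two parts together a proper fraction. -/
theorem steal_potential_le {L H : ℕ} {h : Holding P} (hg : h.Good L H) (hd : h.deque ≠ []) :
    h.rest.advance.elim 0 (Holding.potential L) + h.loot.potential L ≤ h.potential L * (2 / 3) := by
  obtain ⟨n, hn⟩ : ∃ n, rank h.deque = n + 1 := ⟨rank h.deque - 1, by have := rank_pos hd; omega⟩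
  have he := rank_append_singleton h.rest.deque h.top
  rw [← Holding.deque_eq hd, hn] at he
  have h1 : h.rest.potential L ≤ 3 ^ (n + L) := by
    unfold Holding.potential
    split_ifs
    · exact pow_le_pow_right₀ (by norm_num) ((hg.rest hd).le.trans (by omega))
    · exact pow_le_pow_right₀ (by norm_num) (by omega)
  have h2 : h.loot.potential L ≤ 3 ^ (n + L) := by
    refine (start_potential_le _ h.top [] fun s hs =>
      (hg.sizes h.top (by rw [Holding.deque_eq hd]; simp) s hs).2).trans ?_
    refine pow_le_pow_right₀ (by norm_num) ?_
    simp only [List.length_nil, rank]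
    omega
  have h3 := advance_potential_le (hg.rest hd)
  have h4 : h.potential L = 3 * 3 ^ (n + L) := by
    rw [Holding.potential, if_neg hd, hn, ← pow_succ']
    congr 1
    omega
  rw [h4]
  linarith

/-- The potential of the general steals. -/
noncomputable def State.potential (L : ℕ) (s : State P) : ℝ :=
  s.total fun _ h => h.potential L

theorem State.potential_nonneg (L : ℕ) (s : State P) : 0 ≤ s.potential L :=
  State.total_nonneg fun _ h _ => zero_le_one.trans (h.one_le_potential L)

theorem State.one_le_potential (L : ℕ) {s : State P} (hf : ¬ s.Finished) : 1 ≤ s.potential L := by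
  have h1 : (s.total fun _ _ => (1 : ℝ)) ≤ s.potential L :=
    State.total_mono fun p h _ => h.one_le_potential L
  rw [total_one] at h1
  exact le_trans (by exact_mod_cast Finset.card_pos.2 (busy_nonempty hf)) h1

open Classical in
/-- The indicator that the potential of what `j` holds drops. -/
noncomputable def progress (s : State P) (a : Attempts P) (j : Fin P) (h : Holding P) : ℝ :=
  if h.deque = [] then 1 else if ∃ k ∈ general s, a k = some j then 1 else 0

theorem potential_next_le {L H : ℕ} {s : State P} (hg : s.Good L H) {a : Attempts P}
    {w : Fin P → Fin P} (ha : a ∈ Fintype.piFinset (options s)) (hw : ValidWinners s a w) :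
    (s.next a w).potential L ≤
      s.total fun j h => h.potential L * (1 - 1 / 3 * progress s a j h) := by
  have hpr : ∀ j h, progress s a j h ≤ 1 := fun j h => by
    unfold progress; split_ifs <;> norm_num
  refine total_next_le ha ?_ ?_
  · intro j h hj hh
    by_cases hd : h.deque = []
    · refine (advance_potential_le_of_nil hd).trans (le_of_eq ?_)
      simp [progress, hd]; norm_num
    -- A general thief may take work of any owner, so its attempt on a nonempty deque is eligible
    -- and there would be a theft.
    · have : ¬ ∃ k ∈ general s, a k = some j := by
        rintro ⟨k, hk, hak⟩
        refine hh (hw.hit ⟨hak, h, hj, hd, fun hne => ?_⟩)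
        simp only [general, Finset.mem_filter, Finset.mem_univ, true_and] at hk
        exact absurd hk.2 hne.ne_empty
      refine (advance_potential_le (hg.holding j h hj)).trans (le_of_eq ?_)
      simp [progress, hd, this]
  · intro j h hj hh hd
    refine (steal_potential_le (hg.holding j h hj) hd).trans ?_
    have := hpr j h
    have := h.one_le_potential L
    nlinarith

/-- By concavity `log (1 + Φ') ≤ log (1 + Φ) + (Φ' - Φ) / (1 + Φ)`, which turns a relative decrease
of `Φ` on average into an additive one. The summand 1 keeps the logarithm nonnegative at the end,
when `Φ = 0`. -/
theorem log_potential_drift {L H : ℕ} {s : State P} (hg : s.Good L H) (hf : ¬ s.Finished) :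
    ∃ U : Attempts P → ℝ,
      (∀ a ∈ Fintype.piFinset (options s), ∀ w, ValidWinners s a w →
        Real.log (1 + (s.next a w).potential L) ≤ U a) ∧
      avg s U ≤ Real.log (1 + s.potential L) - (general s).card / (12 * P) := by
  classical
  set Φ := s.potential L with hΦ
  have h1 : 1 ≤ Φ := State.one_le_potential L hf
  set T : Attempts P → ℝ :=
    fun a => s.total fun j h => h.potential L * (1 - 1 / 3 * progress s a j h) with hT
  refine ⟨fun a => Real.log (1 + Φ) + 1 / (1 + Φ) * (T a - Φ), ?_, ?_⟩
  · intro a ha w hw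
    have h2 := potential_next_le hg ha hw
    have h3 := (s.next a w).potential_nonneg L
    have h4 := Real.log_le_sub_one_of_pos
      (show 0 < (1 + (s.next a w).potential L) / (1 + Φ) by positivity)
    rw [Real.log_div (by positivity) (by positivity)] at h4
    have h5 : (1 + (s.next a w).potential L) / (1 + Φ) - 1 =
        1 / (1 + Φ) * ((s.next a w).potential L - Φ) := by
      field_simp; ring
    have h6 : 1 / (1 + Φ) * ((s.next a w).potential L - Φ) ≤ 1 / (1 + Φ) * (T a - Φ) := by
      refine mul_le_mul_of_nonneg_left ?_ (by positivity)
      linarith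
    linarith
  · have hP : (0 : ℝ) < P := by
      obtain ⟨p, -⟩ := busy_nonempty hf
      exact_mod_cast p.pos
    have hTavg : avg s T ≤ Φ * (1 - (general s).card / (6 * P)) := by
      have h2 : avg s T = ∑ p, avg s (fun a => (s.holds p).elim 0
          fun h => h.potential L * (1 - 1 / 3 * progress s a p h)) := by
        rw [hT, ← piAvg_sum]
        rfl
      rw [h2, hΦ, State.potential, State.total, Finset.sum_mul]
      refine Finset.sum_le_sum fun p _ => ?_
      rcases hp : s.holds p with _ | h
      · simp only [Option.elim_none, zero_mul]
        rw [avg, piAvg_const (options_nonempty s)]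
      · simp only [Option.elim_some]
        rw [avg, piAvg_const_mul, piAvg_sub, piAvg_const (options_nonempty s), piAvg_const_mul]
        refine mul_le_mul_of_nonneg_left ?_ (zero_le_one.trans (h.one_le_potential L))
        have h3 : ((general s).card : ℝ) / (2 * P) ≤ piAvg (options s) (fun a => progress s a p h) := by
          unfold progress
          split_ifs with hd
          · rw [piAvg_const (options_nonempty s), div_le_one (by positivity)]
            have := card_busy_add s
            have h4 : ((general s).card : ℝ) ≤ P := by
              exact_mod_cast (by omega : (general s).card ≤ P)
            linarith
          · exact avg_hit_ge (mem_busy.2 ⟨h, hp⟩)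
        have h5 : ((general s).card : ℝ) / (6 * P) = 1 / 3 * ((general s).card / (2 * P)) := by
          field_simp; ring
        rw [h5]
        linarith
    rw [avg, piAvg_add, piAvg_const (options_nonempty s), piAvg_const_mul, piAvg_sub,
      piAvg_const (options_nonempty s)]
    have h6 : 1 / (1 + Φ) * (piAvg (options s) T - Φ) ≤
        1 / (1 + Φ) * (-(Φ * ((general s).card / (6 * P)))) := by
      refine mul_le_mul_of_nonneg_left ?_ (by positivity)
      linarith
    -- In an unfinished state `Φ ≥ 1`, so `Φ / (1 + Φ) ≥ 1 / 2`.
    have h7 : 1 / (1 + Φ) * (-(Φ * ((general s).card / (6 * P)))) ≤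
        -((general s).card / (12 * P)) := by
      have h8 : (0 : ℝ) ≤ (general s).card / (12 * P) := by positivity
      have h9 : ((general s).card : ℝ) / (6 * P) = 2 * ((general s).card / (12 * P)) := by
        field_simp; ring
      rw [h9, one_div_mul_eq_div, div_le_iff₀ (by positivity)]
      nlinarith
    linarith

/-! ### The initial state -/

theorem sum_taskSize {M : Type*} [AddCommMonoid M] (W : Workload P) (f : Fin P → ℕ → M) :
    ∑ x : W.Task, f x.1 (W.taskSize x) = ∑ i, ((W.sizes i).map (f i)).sum := by
  rw [Fintype.sum_sigma]
  refine Finset.sum_congr rfl fun i _ => ?_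
  conv_rhs => rw [← List.ofFn_get (W.sizes i), List.map_ofFn, List.sum_ofFn]
  rfl

theorem Workload.sizes_of_tree {W : Workload P} {i : Fin P} {t : TaskTree} (h : W.tree i = some t) :
    W.sizes i = t.sizes := by
  unfold Workload.sizes
  rw [h]

theorem Workload.sizes_of_none {W : Workload P} {i : Fin P} (h : W.tree i = none) :
    W.sizes i = [] := by
  unfold Workload.sizes
  rw [h]

theorem Workload.exists_task {W : Workload P} {i : Fin P} {n : ℕ} (h : n ∈ W.sizes i) :
    ∃ x : W.Task, x.1 = i ∧ W.taskSize x = n := by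
  obtain ⟨k, hk⟩ := List.get_of_mem h
  exact ⟨⟨i, k⟩, rfl, hk⟩

theorem Workload.le_largestTask {W : Workload P} {i : Fin P} {n : ℕ} (h : n ∈ W.sizes i) :
    n ≤ W.largestTask := by
  obtain ⟨x, -, rfl⟩ := Workload.exists_task h
  exact Finset.le_sup (f := W.taskSize) (Finset.mem_univ x)

theorem Workload.height_le {W : Workload P} {i : Fin P} {t : TaskTree} (h : W.tree i = some t) :
    t.height ≤ W.treeHeight := by
  have h1 := Finset.le_sup (f := fun i : Fin P => match W.tree i with
    | none => 0
    | some t => t.height) (Finset.mem_univ i)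
  have h2 : (match W.tree i with | none => 0 | some t => t.height) ≤ W.treeHeight := h1
  rwa [h] at h2

theorem initial_good (W : Workload P) :
    (State.initial W).Good W.largestTask W.treeHeight where
  holding p h hp := by
    simp only [State.initial, Option.map_eq_some_iff] at hp
    obtain ⟨t, ht, rfl⟩ := hp
    refine good_start p t (W.balanced p t ht) (fun s hs => ⟨W.size_pos p t ht s hs, ?_⟩)
      (Workload.height_le ht)
    exact Workload.le_largestTask (by rwa [Workload.sizes_of_tree ht])
  listed p h hp _ hne := by
    simp only [State.initial, Option.map_eq_some_iff] at hp
    obtain ⟨t, ht, rfl⟩ := hp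
    exact absurd (start_owner p t []).symm hne

theorem initial_volume (W : Workload P) : (State.initial W).volume = W.work := by
  rw [Workload.work, sum_taskSize W fun _ n => n, State.volume, State.total, Nat.cast_sum]
  refine Finset.sum_congr rfl fun p _ => ?_
  simp only [State.initial]
  rcases ht : W.tree p with _ | t
  · simp [Workload.sizes_of_none ht]
  · have := start_weight (fun s => s) p t []
    simp only [dequeWeight_nil, add_zero] at this
    simp only [Option.map_some, Option.elim_some, Holding.volume, Workload.sizes_of_tree ht, this,
      TaskTree.weight]

/-- Initially `Φ ≤ P * 3 ^ (T∞' + L)` with `L` the largest task, so the logarithm is at most `1 +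
⌈lg P⌉ + 2 * (T∞' + L)`; the 1 is absorbed by `T∞' ≥ 1`. -/
theorem initial_log_potential_le (W : Workload P) (hP : 0 < P) (hH : 1 ≤ W.treeHeight) :
    Real.log (1 + (State.initial W).potential W.largestTask) ≤ 3 * W.span := by
  have h1 : (State.initial W).potential W.largestTask ≤
      P * 3 ^ (W.treeHeight + W.largestTask) := by
    have h2 : (P : ℝ) * 3 ^ (W.treeHeight + W.largestTask) =
        ∑ _p : Fin P, (3 : ℝ) ^ (W.treeHeight + W.largestTask) := by simp
    rw [h2, State.potential, State.total]
    refine Finset.sum_le_sum fun p _ => ?_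
    simp only [State.initial]
    rcases ht : W.tree p with _ | t
    · simp only [Option.map_none, Option.elim_none]
      positivity
    · refine (start_potential_le p t [] fun s hs =>
        Workload.le_largestTask (by rwa [Workload.sizes_of_tree ht])).trans ?_
      refine pow_le_pow_right₀ (by norm_num) ?_
      have := Workload.height_le ht
      simp only [List.length_nil, rank]
      omega
  have hP1 : (1 : ℝ) ≤ P := by exact_mod_cast hP
  have h3 : (1 : ℝ) ≤ 3 ^ (W.treeHeight + W.largestTask) := one_le_pow₀ (by norm_num)
  have h4 : 1 + (State.initial W).potential W.largestTask ≤
      2 * (P * 3 ^ (W.treeHeight + W.largestTask)) := by nlinarith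
  have h5 := (State.initial W).potential_nonneg W.largestTask
  have h6 := Real.log_le_log (by linarith) h4
  rw [Real.log_mul (by norm_num) (by positivity), Real.log_mul (by positivity) (by positivity),
    Real.log_pow] at h6
  have l2 : Real.log 2 ≤ 1 := by
    have := Real.log_le_sub_one_of_pos (show (0 : ℝ) < 2 by norm_num); linarith
  have l3 : Real.log 3 ≤ 2 := by
    have := Real.log_le_sub_one_of_pos (show (0 : ℝ) < 3 by norm_num); linarith
  have lP : Real.log P ≤ Nat.clog 2 P := by
    have h7 : (P : ℝ) ≤ 2 ^ Nat.clog 2 P := by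
      exact_mod_cast Nat.le_pow_clog (by norm_num) P
    have h8 := Real.log_le_log (by positivity) h7
    rw [Real.log_pow] at h8
    refine h8.trans ?_
    have : (0 : ℝ) ≤ Nat.clog 2 P := Nat.cast_nonneg _
    nlinarith
  have hH' : (1 : ℝ) ≤ W.treeHeight := by exact_mod_cast hH
  have hc : (0 : ℝ) ≤ Nat.clog 2 P := Nat.cast_nonneg _
  have hL : (0 : ℝ) ≤ W.largestTask := Nat.cast_nonneg _
  have h9 : ((W.treeHeight + W.largestTask : ℕ) : ℝ) * Real.log 3 ≤
      ((W.treeHeight + W.largestTask : ℕ) : ℝ) * 2 :=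
    mul_le_mul_of_nonneg_left l3 (Nat.cast_nonneg _)
  simp only [Workload.span]
  push_cast at h6 h9 ⊢
  linarith

/-- It suffices to account for the steal-backs: a potential that pays for each steal-back, and that each
general steal increases on average by at most `β`, bounds the expected execution time. -/
theorem expectedTime_le_of_stealBacks (σ : ContentionRule P) (W : Workload P) (hP : 0 < P)
    (hH : 1 ≤ W.treeHeight) (S : State P → ℝ) {β : ℝ} (hβ : 0 ≤ β) (hS : ∀ s, 0 ≤ S s)
    (hdrift : ∀ s : State P, s.Good W.largestTask W.treeHeight → ¬ s.Finished →
      ∃ U : Attempts P → ℝ,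
        (∀ a ∈ Fintype.piFinset (options s), ∀ w, ValidWinners s a w → S (s.next a w) ≤ U a) ∧
        avg s U ≤ S s - (backers s).card + β * (general s).card) :
    expectedTime σ W ≤ ENNReal.ofReal
      ((W.work : ℝ) / P + 36 * (1 + β) * W.span + S (State.initial W) / P) := by
  have hP' : (0 : ℝ) < P := by exact_mod_cast hP
  -- The factor `12 * P` turns the drift of the logarithm into the number of general steals; the
  -- factor `1 + β` pays for these and for the increase by `β` each that they cause in `S`.
  set V : State P → ℝ := fun s =>
    s.volume + (1 + β) * (12 * P) * Real.log (1 + s.potential W.largestTask) + S s with hV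
  have h0 := expectedTime_le_of_drift σ W (State.Good W.largestTask W.treeHeight) V hP' ?_
    (initial_good W) (fun s a w hs _ _ => hs.next) ?_
  · refine h0.trans (ENNReal.ofReal_le_ofReal ?_)
    rw [hV]
    dsimp only
    rw [initial_volume, add_div, add_div]
    gcongr
    rw [div_le_iff₀ hP']
    have := mul_le_mul_of_nonneg_left (initial_log_potential_le W hP hH)
      (show 0 ≤ (1 + β) * (12 * P) by positivity)
    linarith
  · intro s _
    have h1 : 0 ≤ s.volume :=
      State.total_nonneg fun _ _ _ => Nat.cast_nonneg _
    have h2 := Real.log_nonneg (by linarith [s.potential_nonneg W.largestTask] :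
      1 ≤ 1 + s.potential W.largestTask)
    have h3 := hS s
    simp only [hV]
    positivity
  · intro s hs hf
    obtain ⟨U, hU, hUa⟩ := hdrift s hs hf
    obtain ⟨T, hT, hTa⟩ := log_potential_drift hs hf
    refine ⟨fun a => (s.volume - (busy s).card) + (1 + β) * (12 * P) * T a + U a, ?_, ?_⟩
    · intro a ha w hw
      have h1 := volume_next_le (w := w) hs ha
      have h2 := mul_le_mul_of_nonneg_left (hT a ha w hw)
        (show 0 ≤ (1 + β) * (12 * P) by positivity)
      have h3 := hU a ha w hw
      simp only [hV]
      linarith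
    · have h1 : avg s (fun a => (s.volume - (busy s).card) + (1 + β) * (12 * P) * T a + U a) =
          (s.volume - (busy s).card) + (1 + β) * (12 * P) * avg s T + avg s U := by
        rw [avg, piAvg_add, piAvg_add, piAvg_const (options_nonempty s), piAvg_const_mul]
      rw [h1]
      have h2 := mul_le_mul_of_nonneg_left hTa (show 0 ≤ (1 + β) * (12 * P) by positivity)
      have h3 : (1 + β) * (12 * P) * ((general s).card / (12 * P)) = (1 + β) * (general s).card := by
        field_simp
      have h4 : ((busy s).card : ℝ) + (general s).card + (backers s).card = P := by
        exact_mod_cast card_busy_add s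
      simp only [hV]
      rw [mul_sub, h3] at h2
      linarith

/-! ### Steal-backs and the lists of helpers -/

/-- `j` has a branch that `o` could steal back. -/
def Stealable (s : State P) (o j : Fin P) : Prop :=
  ∃ h, s.holds j = some h ∧ h.deque ≠ [] ∧ h.owner = o

theorem mem_general {s : State P} {i : Fin P} :
    i ∈ general s ↔ s.holds i = none ∧ s.helpers i = ∅ := by simp [general]

theorem mem_backers {s : State P} {i : Fin P} :
    i ∈ backers s ↔ s.holds i = none ∧ (s.helpers i).Nonempty := by simp [backers]

theorem eligible_backer_iff {s : State P} {a : Attempts P} {o j : Fin P} (ho : o ∈ backers s) :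
    Eligible s a o j ↔ a o = some j ∧ Stealable s o j := by
  have := (mem_backers.1 ho).2
  simp [Eligible, Stealable, this]

theorem exists_attempt_of_backer {s : State P} {a : Attempts P}
    (ha : a ∈ Fintype.piFinset (options s)) {o : Fin P} (ho : o ∈ backers s) :
    ∃ j ∈ s.helpers o, a o = some j := by
  have := Fintype.mem_piFinset.1 ha o
  rw [options_backers ho, Finset.mem_image] at this
  obtain ⟨j, hj, he⟩ := this
  exact ⟨j, hj, he.symm⟩

-- A steal-back aimed at a stealable branch entails a theft from that victim, possibly by another
-- processor. A holding has only one owner, so no theft is charged twice.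
open Classical in
theorem sum_stealBack_le {s : State P} {a : Attempts P} {w : Fin P → Fin P}
    (hw : ValidWinners s a w) (c : Fin P → Holding P → ℝ) (hc : ∀ j h, 0 ≤ c j h) :
    ∑ o ∈ backers s, (a o).elim 0 (fun j =>
        if Stealable s o j then (s.holds j).elim 0 (c j) else 0) ≤
      s.total fun j h => if Hit s a w j then c j h else 0 := by
  have h1 : ∀ o, (a o).elim 0 (fun j => if Stealable s o j then (s.holds j).elim 0 (c j) else 0) =
      ∑ j, if a o = some j ∧ Stealable s o j then (s.holds j).elim 0 (c j) else 0 := by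
    intro o
    rcases hao : a o with _ | j
    · simp
    · rw [Finset.sum_eq_single j]
      · simp
      · intro k _ hk
        rw [if_neg]
        rintro ⟨h2, -⟩
        exact hk (Option.some.inj h2).symm
      · simp
  simp only [h1]
  rw [Finset.sum_comm]
  refine Finset.sum_le_sum fun j _ => ?_
  rcases hj : s.holds j with _ | h
  · simp
  · simp only [Option.elim_some]
    by_cases hex : ∃ o ∈ backers s, a o = some j ∧ Stealable s o j
    · obtain ⟨o, ho, hao, hst⟩ := hex
      rw [if_pos (hw.hit ((eligible_backer_iff ho).2 ⟨hao, hst⟩)), Finset.sum_eq_single o]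
      · rw [if_pos ⟨hao, hst⟩]
      · intro o' _ hne
        rw [if_neg]
        rintro ⟨-, h', hj', -, ho'⟩
        obtain ⟨h'', hj'', -, ho''⟩ := hst
        rw [hj'] at hj''
        cases hj''
        exact hne (ho'.symm.trans ho'')
      · exact fun h' => absurd ho h'
    · push Not at hex
      rw [Finset.sum_eq_zero fun o ho => if_neg fun h' => hex o ho h'.1 h'.2]
      split_ifs
      · exact hc j h
      · exact le_rfl

open Classical in
/-- The processors that take work of `o` in a general steal. -/
noncomputable def newHelpers (s : State P) (a : Attempts P) (w : Fin P → Fin P) (o : Fin P) :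
    Finset (Fin P) :=
  Finset.univ.filter fun k => k ≠ o ∧ s.helpers k = ∅ ∧
    ∃ j h, Succeeds s a w k j ∧ s.holds j = some h ∧ h.owner = o

theorem sum_card_newHelpers_le {s : State P} {a : Attempts P} {w : Fin P → Fin P}
    (ha : a ∈ Fintype.piFinset (options s)) :
    ∑ o, (newHelpers s a w o).card ≤ (general s).card := by
  classical
  rw [← Finset.card_biUnion]
  · refine Finset.card_le_card fun k hk => ?_
    simp only [newHelpers, Finset.mem_biUnion, Finset.mem_filter, Finset.mem_univ, true_and] at hk
    obtain ⟨o, -, he, j, h, hs, -⟩ := hk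
    exact mem_general.2 ⟨hs.1.free ha, he⟩
  · intro o _ o' _ hne
    rw [Function.onFun, Finset.disjoint_left]
    intro k hk hk'
    simp only [newHelpers, Finset.mem_filter, Finset.mem_univ, true_and] at hk hk'
    obtain ⟨-, -, j, h, hs, hj, ho⟩ := hk
    obtain ⟨-, -, j', h', hs', hj', ho'⟩ := hk'
    have := hs.1.1.symm.trans hs'.1.1
    cases this
    rw [hj] at hj'
    cases hj'
    exact hne (ho.symm.trans ho')

open Classical in
theorem card_nextHelpers_le (s : State P) (a : Attempts P) (w : Fin P → Fin P) (o : Fin P) :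
    (nextHelpers s a w o).card ≤ (s.helpers o).card + (newHelpers s a w o).card := by
  unfold nextHelpers newHelpers
  exact (Finset.card_union_le _ _).trans
    (Nat.add_le_add_right (Finset.card_le_card (Finset.filter_subset _ _)) _)

open Classical in
theorem card_nextHelpers_le_of_failure {s : State P} {a : Attempts P} {w : Fin P → Fin P}
    {o j : Fin P} (ho : o ∈ backers s) (hj : j ∈ s.helpers o) (ha : a o = some j)
    (hn : ¬ Stealable s o j) :
    (nextHelpers s a w o).card + 1 ≤ (s.helpers o).card + (newHelpers s a w o).card := by
  have h1 : ((s.helpers o).filter fun j => ¬ (a o = some j ∧ ¬ Eligible s a o j)) ⊆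
      (s.helpers o).erase j := by
    intro k hk
    rw [Finset.mem_filter] at hk
    refine Finset.mem_erase.2 ⟨?_, hk.1⟩
    rintro rfl
    exact hk.2 ⟨ha, fun he => hn ((eligible_backer_iff ho).1 he).2⟩
  have h2 := Finset.card_le_card h1
  rw [Finset.card_erase_of_mem hj] at h2
  have h3 : 0 < (s.helpers o).card := Finset.card_pos.2 ⟨j, hj⟩
  have h4 : (nextHelpers s a w o).card ≤ _ := Finset.card_union_le _ _
  have h5 : (newHelpers s a w o).card = (Finset.univ.filter fun k => k ≠ o ∧ s.helpers k = ∅ ∧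
    ∃ j h, Succeeds s a w k j ∧ s.holds j = some h ∧ h.owner = o).card := rfl
  omega

/-! ### Paying for the steal-backs with the heights of the stolen trees -/

theorem advance_rank_le (h : Holding P) :
    h.advance.elim 0 (fun x => rank x.deque) ≤ rank h.deque := by
  unfold Holding.advance
  split_ifs with h1
  · exact le_rfl
  · split
    · exact Nat.zero_le _
    · next t d hd =>
      refine (start_rank _ t d).trans ?_
      rw [hd, rank]
      omega

/-- The rank of the deque of a holding of a processor that is not its owner. -/
def foreignRank (p : Fin P) (h : Holding P) : ℝ := if h.owner = p then 0 else (rank h.deque : ℝ)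

theorem foreignRank_advance_le (p : Fin P) (h : Holding P) :
    h.advance.elim 0 (foreignRank p) ≤ foreignRank p h := by
  have h1 := advance_rank_le h
  rcases ha : h.advance with _ | h'
  · simp only [Option.elim_none, foreignRank]
    split_ifs <;> positivity
  · rw [ha] at h1
    simp only [Option.elim_some, foreignRank, advance_owner ha] at h1 ⊢
    split_ifs
    · exact le_rfl
    · exact_mod_cast h1

/-- The number of steal-backs that the present state can still pay for. -/
noncomputable def State.heightPotential (s : State P) : ℝ :=
  s.total foreignRank + ∑ o, ((s.helpers o).card : ℝ)

-- A theft from a helper lowers its rank by one. The loot has rank 0 for its owner, and a general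
-- thief gets rank at most `H`. So a steal-back from a stealable victim is paid for by that victim's
-- rank even if it loses the contention, any other one by the removal of its target from the list. A
-- general thief adds at most `H` in rank and one list entry.
open Classical in
theorem heightPotential_next_le {L H : ℕ} {s : State P} (hg : s.Good L H) {a : Attempts P}
    {w : Fin P → Fin P} (ha : a ∈ Fintype.piFinset (options s)) (hw : ValidWinners s a w) :
    (s.next a w).heightPotential ≤
      s.heightPotential - (backers s).card + (H + 1) * (general s).card := by
  have h1 : (s.next a w).total foreignRank ≤
      s.total fun j h => foreignRank j h -
        ((if Hit s a w j then (if h.owner = j then 0 else 1) else 0) -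
          (if Hit s a w j ∧ w j ∈ general s then (H : ℝ) else 0)) := by
    refine total_next_le ha ?_ ?_
    · intro j h hj hh
      simpa [hh] using foreignRank_advance_le j h
    · intro j h hj hh hd
      have h2 := foreignRank_advance_le j h.rest
      have h3 := hh.eligible
      have h4 := h3.free ha
      have h5 := (rank_append_singleton h.rest.deque h.top).1
      rw [← Holding.deque_eq hd] at h5
      have h6 : foreignRank j h.rest ≤ foreignRank j h - if h.owner = j then 0 else 1 := by
        unfold foreignRank
        rw [show h.rest.owner = h.owner from rfl]
        split_ifs
        · simp
        · have : (rank h.rest.deque : ℝ) + 1 ≤ rank h.deque := by exact_mod_cast h5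
          linarith
      simp only [hh, if_true, true_and]
      by_cases hl : w j ∈ general s
      · have h7 : foreignRank (w j) h.loot ≤ H := by
          unfold foreignRank
          split_ifs
          · positivity
          · exact_mod_cast ((hg.holding j h hj).loot hd).rank_le
        rw [if_pos hl]
        linarith
      · have h7 : (s.helpers (w j)).Nonempty := by
          by_contra hne
          exact hl (mem_general.2 ⟨h4, Finset.not_nonempty_iff_eq_empty.1 hne⟩)
        obtain ⟨-, y, hy, -, ho⟩ := h3
        rw [hj] at hy
        cases hy
        have h8 : foreignRank (w j) h.loot = 0 := by
          rw [foreignRank, h.loot_owner, if_pos (ho h7)]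
        rw [if_neg hl]
        linarith
  rw [State.total_sub, State.total_sub] at h1
  have h2 := sum_stealBack_le hw (fun j h => if h.owner = j then (0 : ℝ) else 1)
    (fun j h => by split_ifs <;> norm_num)
  have h3 : (s.total fun j _ => if Hit s a w j ∧ w j ∈ general s then (H : ℝ) else 0) ≤
      H * (general s).card := by
    have h4 : (s.total fun j _ => if Hit s a w j ∧ w j ∈ general s then (H : ℝ) else 0) ≤
        ∑ j, if Hit s a w j ∧ w j ∈ general s then (H : ℝ) else 0 := by
      refine Finset.sum_le_sum fun j _ => ?_
      rcases s.holds j with _ | h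
      · simp only [Option.elim_none]; split_ifs <;> positivity
      · exact le_rfl
    refine h4.trans ?_
    rw [← Finset.sum_filter, Finset.sum_const, nsmul_eq_mul, mul_comm]
    refine mul_le_mul_of_nonneg_left ?_ (Nat.cast_nonneg _)
    -- A processor makes one attempt, so it wins at most one victim.
    have h5 : (Finset.univ.filter fun j => Hit s a w j ∧ w j ∈ general s).card ≤
        (general s).card := by
      refine Finset.card_le_card_of_injOn w (fun j hj => ?_) ?_
      · exact (Finset.mem_filter.1 hj).2.2
      · intro j hj j' hj' he
        have e1 := (Finset.mem_filter.1 hj).2.1.eligible.1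
        have e2 := (Finset.mem_filter.1 hj').2.1.eligible.1
        rw [he, e2] at e1
        exact (Option.some.inj e1).symm
    exact_mod_cast h5
  have h4 : ∑ o, ((nextHelpers s a w o).card : ℝ) +
      ∑ o ∈ backers s, (1 - (a o).elim 0 (fun j => if Stealable s o j then (s.holds j).elim 0
        (fun h => if h.owner = j then (0 : ℝ) else 1) else 0)) ≤
      ∑ o, ((s.helpers o).card : ℝ) + (general s).card := by
    have h5 : ∑ o, ((newHelpers s a w o).card : ℝ) ≤ (general s).card := by
      exact_mod_cast sum_card_newHelpers_le (w := w) ha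
    refine le_trans ?_ (add_le_add_right h5 _)
    rw [← Finset.sum_filter_add_sum_filter_not Finset.univ (· ∈ backers s),
      ← Finset.sum_add_distrib,
      ← Finset.sum_filter_add_sum_filter_not Finset.univ (· ∈ backers s)
        fun o => ((s.helpers o).card : ℝ) + ((newHelpers s a w o).card : ℝ),
      Finset.filter_mem_eq_inter, Finset.univ_inter, add_right_comm, ← Finset.sum_add_distrib]
    refine add_le_add (Finset.sum_le_sum fun o ho => ?_) (Finset.sum_le_sum fun o _ => ?_)
    · obtain ⟨j, hj, hao⟩ := exists_attempt_of_backer ha ho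
      rw [hao]
      simp only [Option.elim_some]
      by_cases hst : Stealable s o j
      · obtain ⟨h, hh, hd, hown⟩ := hst
        -- The owner is free while its victim is busy; hence the theft is from a non-owner and does
        -- lower a foreign rank.
        have hne : h.owner ≠ j := by
          rintro rfl
          rw [hown, (mem_backers.1 ho).1] at hh
          cases hh
        have : ((nextHelpers s a w o).card : ℝ) ≤
            (s.helpers o).card + (newHelpers s a w o).card := by
          exact_mod_cast card_nextHelpers_le s a w o
        rw [if_pos ⟨h, hh, hd, hown⟩, hh]
        simpa [hne] using this
      · rw [if_neg hst, sub_zero]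
        exact_mod_cast card_nextHelpers_le_of_failure (w := w) ho hj hao hst
    · exact_mod_cast card_nextHelpers_le s a w o
  rw [Finset.sum_sub_distrib, Finset.sum_const, nsmul_eq_mul, mul_one] at h4
  simp only [State.heightPotential, State.next] at h1 ⊢
  linarith

theorem expectedTime_le_height (σ : ContentionRule P) (W : Workload P) (hP : 0 < P)
    (hH : 1 ≤ W.treeHeight) :
    expectedTime σ W ≤ ENNReal.ofReal
      ((W.work : ℝ) / P + 108 * (W.span * W.treeHeight)) := by
  have h0 := expectedTime_le_of_stealBacks σ W hP hH State.heightPotential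
    (β := W.treeHeight + 1) (by positivity)
    (fun s => add_nonneg (State.total_nonneg fun p h _ => by unfold foreignRank; split_ifs <;> positivity)
      (Finset.sum_nonneg fun _ _ => Nat.cast_nonneg _))
    (fun s hs _ => ⟨fun _ => s.heightPotential - (backers s).card +
      (W.treeHeight + 1) * (general s).card, fun a ha w hw => heightPotential_next_le hs ha hw,
      (piAvg_const (options_nonempty s) _).le⟩)
  refine h0.trans (ENNReal.ofReal_le_ofReal ?_)
  have h1 : (State.initial W).heightPotential = 0 := by
    have h2 : (State.initial W).total foreignRank = 0 := by
      refine Finset.sum_eq_zero fun p _ => ?_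
      simp only [State.initial]
      rcases W.tree p with _ | t
      · rfl
      · simp [foreignRank, start_owner]
    rw [State.heightPotential, h2]
    simp [State.initial]
  rw [h1, zero_div, add_zero]
  -- With `β = T∞' + 1` the factor is `36 * (T∞' + 2) ≤ 108 * T∞'`.
  have h3 : (1 : ℝ) ≤ W.treeHeight := by exact_mod_cast hH
  have h4 : (0 : ℝ) ≤ W.span := Nat.cast_nonneg _
  nlinarith

/-! ### Truncated contents and exceptional tasks of a holding -/

/-- The remaining work of a holding from which something can be stolen, with tasks truncated at `hi`. -/
def Holding.content (hi : ℕ) (h : Holding P) : ℕ :=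
  if h.deque = [] then 0 else min h.timeLeft hi + dequeWeight (fun s => min s hi) h.deque

theorem Holding.content_le_volume (hi : ℕ) (h : Holding P) : h.content hi ≤ h.volume := by
  unfold Holding.content Holding.volume
  split_ifs
  · exact Nat.zero_le _
  · exact add_le_add (min_le_left _ _) (dequeWeight_mono _ fun _ _ s _ => min_le_left _ _)

theorem start_content_le (hi : ℕ) (o : Fin P) (t : TaskTree) (d : List TaskTree) :
    (Holding.start o t d).content hi ≤
      t.weight (fun s => min s hi) + dequeWeight (fun s => min s hi) d := by
  rw [← start_weight (fun s => min s hi) o t d]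
  unfold Holding.content
  split_ifs
  · exact Nat.zero_le _
  · exact le_rfl

theorem advance_content_le (hi : ℕ) (h : Holding P) :
    h.advance.elim 0 (Holding.content hi) ≤ h.content hi := by
  unfold Holding.advance
  split_ifs with h1
  · simp only [Option.elim_some, Holding.content]
    split_ifs
    · exact le_rfl
    · omega
  · split
    · exact Nat.zero_le _
    · next t d hd =>
      refine (start_content_le hi _ t d).trans ?_
      simp [Holding.content, hd]

theorem steal_content_le (hi : ℕ) {h : Holding P} (hd : h.deque ≠ []) :
    h.rest.content hi + h.loot.content hi ≤ h.content hi := by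
  have h1 := start_content_le hi h.owner h.top []
  have h2 : h.rest.content hi ≤ min h.timeLeft hi + dequeWeight (fun s => min s hi) h.rest.deque := by
    unfold Holding.content
    split_ifs
    · exact Nat.zero_le _
    · exact le_rfl
  have h3 : h.content hi = min h.timeLeft hi + dequeWeight (fun s => min s hi) h.deque := if_neg hd
  rw [Holding.deque_eq hd] at h3
  simp only [dequeWeight_append, dequeWeight_cons, dequeWeight_nil] at h1 h3
  unfold Holding.loot
  omega

/-- A bound on what remains of the content after `T` time steps of work. -/
def Holding.leftover (hi T : ℕ) (h : Holding P) : ℕ := min (h.content hi) (h.volume - T)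

theorem advance_leftover_le (hi : ℕ) {T T' : ℕ} (hT : T ≤ T' + 1) {h : Holding P}
    (hp : 1 ≤ h.timeLeft) : h.advance.elim 0 (Holding.leftover hi T') ≤ h.leftover hi T := by
  have h1 := advance_content_le hi h
  have h2 := advance_volume hp
  rcases ha : h.advance with _ | h'
  · exact Nat.zero_le _
  · rw [ha] at h1 h2
    simp only [Option.elim_some, Holding.leftover] at *
    omega

/-- Splitting a holding only helps: both parts are then worked on at the same time. The step just
made accounts for the unit by which the horizon shrinks. -/
theorem steal_leftover_le (hi : ℕ) {T T' : ℕ} (hT : T ≤ T' + 1) {h : Holding P}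
    (hp : 1 ≤ h.timeLeft) (hd : h.deque ≠ []) :
    h.rest.advance.elim 0 (Holding.leftover hi T') + h.loot.leftover hi T' ≤ h.leftover hi T := by
  have h1 := advance_content_le hi h.rest
  have h2 := advance_volume (h := h.rest) hp
  have h3 := steal_content_le hi hd
  have h4 := rest_volume hd
  have h5 := h.loot.content_le_volume hi
  rcases ha : h.rest.advance with _ | h'
  · rw [ha] at h1 h2
    simp only [Option.elim_none, Holding.leftover] at *
    omega
  · rw [ha] at h1 h2
    have h6 := h'.content_le_volume hi
    simp only [Option.elim_some, Holding.leftover] at *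
    omega

/-- `1` for an exceptional task, of a size outside `[lo, hi]`. -/
def exceptional (lo hi s : ℕ) : ℕ := if lo ≤ s ∧ s ≤ hi then 0 else 1

/-- The number of exceptional tasks of a holding. -/
def Holding.exceptions (lo hi : ℕ) (h : Holding P) : ℕ :=
  dequeWeight (exceptional lo hi) h.deque + if hi < h.timeLeft then 1 else 0

/-- A bound on how often the exceptional tasks of a deque can still be affected by steals. -/
def dequeExposure (f : ℕ → ℕ) : List TaskTree → ℕ
  | [] => 0
  | t :: d => t.weight f * (t.height + d.length + 1) + dequeExposure f d

/-- A bound on how often the exceptional tasks of a holding can still be affected by steals. -/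
def Holding.exposure (lo hi : ℕ) (h : Holding P) : ℕ :=
  dequeExposure (exceptional lo hi) h.deque + if hi < h.timeLeft then h.deque.length else 0

/-- As for `start_rank`: height plus deque length does not grow on the way down. The task in
execution counts only if it is too large, and then with the number of branches that can still be
stolen above it. -/
theorem start_exposure_le (lo hi : ℕ) (o : Fin P) (t : TaskTree) (d : List TaskTree) :
    (Holding.start o t d).exposure lo hi ≤
      t.weight (exceptional lo hi) * (t.height + d.length) +
        dequeExposure (exceptional lo hi) d := by
  induction t generalizing d with
  | leaf s =>
    simp only [Holding.start, Holding.exposure, TaskTree.weight_leaf, TaskTree.height, exceptional]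
    rcases lt_or_ge hi s with h | h
    · have h1 : ¬ (lo ≤ s ∧ s ≤ hi) := by omega
      simp only [h, h1, if_true, if_false]
      omega
    · simp only [not_lt.2 h, if_false]
      omega
  | node l r hl hr =>
    refine (hl _).trans ?_
    simp only [dequeExposure, List.length_cons, TaskTree.weight_node, TaskTree.height, add_mul]
    have h1 : l.weight (exceptional lo hi) * (l.height + (d.length + 1)) ≤
        l.weight (exceptional lo hi) * (max l.height r.height + 1 + d.length) :=
      Nat.mul_le_mul_left _ (by omega)
    have h2 : r.weight (exceptional lo hi) * (r.height + d.length + 1) ≤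
        r.weight (exceptional lo hi) * (max l.height r.height + 1 + d.length) :=
      Nat.mul_le_mul_left _ (by omega)
    omega

theorem advance_exposure_le (lo hi : ℕ) (h : Holding P) :
    h.advance.elim 0 (Holding.exposure lo hi) ≤ h.exposure lo hi := by
  unfold Holding.advance
  split_ifs with h1
  · simp only [Option.elim_some, Holding.exposure]
    split_ifs <;> omega
  · split
    · exact Nat.zero_le _
    · next t d hd =>
      refine (start_exposure_le lo hi _ t d).trans ?_
      simp only [Holding.exposure, hd, dequeExposure, mul_add]
      omega

theorem dequeExposure_append (f : ℕ → ℕ) (d : List TaskTree) (t : TaskTree) :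
    dequeExposure f (d ++ [t]) =
      dequeExposure f d + dequeWeight f d + t.weight f * (t.height + 1) := by
  induction d with
  | nil => simp [dequeExposure]
  | cons u d ih =>
    simp only [List.cons_append, dequeExposure, ih, dequeWeight_cons, List.length_append,
      List.length_singleton]
    ring

/-- Every exceptional task of the holding loses one unit: in the stolen branch the weight `height +
1` becomes at most `height`, and below it the deque gets shorter by one. -/
theorem steal_exposure_le (lo hi : ℕ) {h : Holding P} (hd : h.deque ≠ []) :
    h.rest.advance.elim 0 (Holding.exposure lo hi) + h.loot.exposure lo hi +
      h.exceptions lo hi ≤ h.exposure lo hi := by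
  have h1 := advance_exposure_le lo hi h.rest
  have h2 := start_exposure_le lo hi h.owner h.top []
  have h3 : h.rest.exposure lo hi = dequeExposure (exceptional lo hi) h.rest.deque +
    if hi < h.timeLeft then h.rest.deque.length else 0 := rfl
  have h4 : h.loot.exposure lo hi ≤ h.top.weight (exceptional lo hi) * h.top.height := by
    simpa [dequeExposure, Holding.loot] using h2
  have h5 : h.exposure lo hi = dequeExposure (exceptional lo hi) h.deque +
    if hi < h.timeLeft then h.deque.length else 0 := rfl
  have h6 : h.exceptions lo hi = dequeWeight (exceptional lo hi) h.deque +
    if hi < h.timeLeft then 1 else 0 := rfl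
  rw [Holding.deque_eq hd] at h5 h6
  rw [dequeExposure_append] at h5
  simp only [dequeWeight_append, dequeWeight_cons, dequeWeight_nil, List.length_append,
    List.length_singleton, mul_add, mul_one] at h5 h6
  split_ifs at h3 h5 h6 <;> omega

/-! ### Balanced holdings of mostly ordinary tasks -/

/-- The task in execution, the other branches and the topmost branch each contribute at most `hi`
times the number of tasks in the topmost branch. Truncation at `hi` is what keeps huge exceptional
tasks from spoiling this. -/
theorem content_le_top {L H : ℕ} (hi : ℕ) {h : Holding P} (hg : h.Good L H) (hd : h.deque ≠ []) :
    h.content hi ≤ 3 * h.top.sizes.length * hi := by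
  have h1 := hg.balanced
  rw [Holding.deque_eq hd] at h1
  obtain ⟨-, -, h2⟩ := h1.of_append
  have h3 : h.content hi = min h.timeLeft hi + dequeWeight (fun s => min s hi) h.deque := if_neg hd
  rw [Holding.deque_eq hd] at h3
  simp only [dequeWeight_append, dequeWeight_cons, dequeWeight_nil, add_zero] at h3
  have h4 : h.top.weight (fun s => min s hi) ≤ hi * h.top.sizes.length := by
    rw [TaskTree.length_sizes, ← TaskTree.weight_mul]
    exact TaskTree.weight_mono _ fun s _ => by simp
  have h5 : dequeWeight (fun s => min s hi) h.rest.deque ≤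
      hi * dequeWeight (fun _ => 1) h.rest.deque := by
    unfold dequeWeight
    rw [← List.sum_map_mul_left]
    refine List.sum_le_sum fun t _ => ?_
    rw [← TaskTree.weight_mul]
    exact TaskTree.weight_mono _ fun s _ => by simp
  have h6 : hi * dequeWeight (fun _ => 1) h.rest.deque ≤ hi * h.top.sizes.length :=
    Nat.mul_le_mul_left _ (by omega)
  have h7 : min h.timeLeft hi ≤ hi * h.top.sizes.length :=
    (min_le_right _ _).trans (Nat.le_mul_of_pos_right _ h.top.one_le_length)
  have h8 : 3 * h.top.sizes.length * hi = hi * h.top.sizes.length + hi * h.top.sizes.length +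
    hi * h.top.sizes.length := by ring
  omega

theorem top_weight_ge (lo hi : ℕ) (t : TaskTree) :
    lo * t.sizes.length ≤ t.weight (fun s => s) + lo * t.weight (exceptional lo hi) := by
  rw [← TaskTree.weight_mul, ← TaskTree.weight_add]
  refine le_weight_of_forall t fun s _ => ?_
  unfold exceptional
  split_ifs with h
  · omega
  · omega

theorem top_exceptions_le (lo hi : ℕ) {h : Holding P} (hd : h.deque ≠ []) :
    h.top.weight (exceptional lo hi) ≤ h.exceptions lo hi := by
  unfold Holding.exceptions
  rw [Holding.deque_eq hd]
  simp
  omega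

theorem ordinary_of_weight_eq_zero {lo hi : ℕ} {t : TaskTree}
    (h : t.weight (exceptional lo hi) = 0) {s : ℕ} (hs : s ∈ t.sizes) : lo ≤ s ∧ s ≤ hi := by
  have h1 := List.sum_eq_zero_iff.1 h (exceptional lo hi s) (List.mem_map_of_mem hs)
  unfold exceptional at h1
  split_ifs at h1 with h2
  exact h2

theorem ordinary_of_exceptions_eq_zero {lo hi : ℕ} {h : Holding P} (he : h.exceptions lo hi = 0) :
    h.timeLeft ≤ hi ∧ ∀ t ∈ h.deque, ∀ s ∈ t.sizes, lo ≤ s ∧ s ≤ hi := by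
  unfold Holding.exceptions at he
  rw [Nat.add_eq_zero_iff] at he
  refine ⟨by by_contra h1; rw [if_pos (by omega)] at he; omega, fun t ht s hs => ?_⟩
  exact ordinary_of_weight_eq_zero (List.sum_eq_zero_iff.1 he.1 _ (List.mem_map_of_mem ht)) hs

theorem content_eq_volume {lo hi : ℕ} {h : Holding P} (he : h.exceptions lo hi = 0)
    (hd : h.deque ≠ []) : h.content hi = h.volume := by
  obtain ⟨h1, h2⟩ := ordinary_of_exceptions_eq_zero he
  refine le_antisymm (h.content_le_volume hi) ?_
  rw [Holding.content, if_neg hd, min_eq_left h1]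
  exact Nat.add_le_add_left (dequeWeight_mono _ fun t ht s hs => le_min le_rfl (h2 t ht s hs).2) _

theorem le_content {lo hi : ℕ} {h : Holding P} (he : h.exceptions lo hi = 0)
    (hd : h.deque ≠ []) : lo ≤ h.content hi := by
  obtain ⟨h1, h2⟩ := ordinary_of_exceptions_eq_zero he
  have h3 : h.top ∈ h.deque := by rw [Holding.deque_eq hd]; simp
  have h4 : lo * h.top.sizes.length ≤ h.top.weight (fun s => min s hi) :=
    le_weight_of_forall _ fun s hs => le_min (h2 _ h3 s hs).1 ((h2 _ h3 s hs).1.trans (h2 _ h3 s hs).2)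
  have h5 : lo ≤ lo * h.top.sizes.length := Nat.le_mul_of_pos_right _ h.top.one_le_length
  rw [Holding.content, if_neg hd, Holding.deque_eq hd]
  simp
  omega

/-! ### The work of an owner -/

/-- The truncated content of the work of `o`. -/
noncomputable def ownContent (hi : ℕ) (s : State P) (o : Fin P) : ℕ :=
  s.total fun _ h => if h.owner = o then h.content hi else 0

/-- A bound on what other processors hold of the content of the work of `o` after `T` steps. -/
noncomputable def ownLeftover (hi : ℕ) (s : State P) (o : Fin P) (T : ℕ) : ℕ :=
  s.total fun p h => if p ≠ o ∧ h.owner = o then h.leftover hi T else 0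

/-- The time for which `o` is going to work on its own work if nothing is stolen from it. -/
def ownTime (s : State P) (o : Fin P) : ℕ :=
  (s.holds o).elim 0 fun h => if h.owner = o then h.volume else 0

open Classical in
/-- The listed helpers of `o` from which something could be stolen back and that have more than `T`
units of work left. -/
noncomputable def active (s : State P) (o : Fin P) (T : ℕ) : Finset (Fin P) :=
  (s.helpers o).filter fun p => p ≠ o ∧
    ∃ h, s.holds p = some h ∧ h.owner = o ∧ h.deque ≠ [] ∧ T < h.volume

open Classical in
/-- The processors that hold work of `o`. -/
noncomputable def holders (s : State P) (o : Fin P) : Finset (Fin P) :=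
  Finset.univ.filter fun p => ∃ h, s.holds p = some h ∧ h.owner = o

theorem mem_holders {s : State P} {o p : Fin P} :
    p ∈ holders s o ↔ ∃ h, s.holds p = some h ∧ h.owner = o := by
  simp [holders]

theorem sum_card_holders (s : State P) : ∑ o, (holders s o).card = (busy s).card := by
  classical
  rw [← Finset.card_biUnion]
  · congr 1
    ext p
    simp [mem_holders, mem_busy]
  · intro o _ o' _ hne
    rw [Function.onFun, Finset.disjoint_left]
    intro k hk hk'
    obtain ⟨h, hh, ho⟩ := mem_holders.1 hk
    obtain ⟨h', hh', ho'⟩ := mem_holders.1 hk'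
    rw [hh] at hh'
    cases hh'
    exact hne (ho.symm.trans ho')

theorem active_subset_holders (s : State P) (o : Fin P) (T : ℕ) : active s o T ⊆ holders s o := by
  intro p hp
  obtain ⟨-, -, h, hh, ho, -⟩ := Finset.mem_filter.1 hp
  exact mem_holders.2 ⟨h, hh, ho⟩

theorem active_anti (s : State P) (o : Fin P) {T T' : ℕ} (hT : T ≤ T') :
    active s o T' ⊆ active s o T := by
  intro p hp
  obtain ⟨hl, hne, h, hh, ho, hd, hv⟩ := Finset.mem_filter.1 hp
  exact Finset.mem_filter.2 ⟨hl, hne, h, hh, ho, hd, by omega⟩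

theorem ownLeftover_le_ownContent (hi : ℕ) (s : State P) (o : Fin P) (T : ℕ) :
    ownLeftover hi s o T ≤ ownContent hi s o := by
  refine State.total_mono fun p h _ => ?_
  split_ifs with h1 h2 h2
  · exact min_le_left _ _
  · exact absurd h1.2 h2
  · exact Nat.zero_le _
  · exact le_rfl

theorem ownLeftover_zero {s : State P} {o : Fin P} (ho : s.holds o = none) (hi : ℕ) :
    ownLeftover hi s o 0 = ownContent hi s o := by
  unfold ownLeftover ownContent State.total
  refine Finset.sum_congr rfl fun p _ => ?_
  rcases hp : s.holds p with _ | h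
  · rfl
  · have hne : p ≠ o := by rintro rfl; rw [ho] at hp; cases hp
    simp only [Option.elim_some, hne, ne_eq, not_false_eq_true, true_and, Holding.leftover,
      Nat.sub_zero, min_eq_left (h.content_le_volume hi)]

theorem elim_ite_owner (o : Fin P) (x : Option (Holding P)) (h : Holding P) (f : Holding P → ℕ)
    (q : Prop) [Decidable q] (hx : ∀ h', x = some h' → h'.owner = h.owner) :
    x.elim 0 (fun h' => if q ∧ h'.owner = o then f h' else 0) =
      if q ∧ h.owner = o then x.elim 0 f else 0 := by
  rcases x with _ | h'
  · simp
  · simp [hx h' rfl]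

theorem ownContent_next_le (hi : ℕ) {s : State P} {a : Attempts P} {w : Fin P → Fin P}
    (ha : a ∈ Fintype.piFinset (options s)) (o : Fin P) :
    ownContent hi (s.next a w) o ≤ ownContent hi s o := by
  have e1 : ∀ h : Holding P, h.advance.elim 0 (fun h' => if h'.owner = o then h'.content hi else 0) =
      if h.owner = o then h.advance.elim 0 (Holding.content hi) else 0 := fun h => by
    have := elim_ite_owner o h.advance h (Holding.content hi) True fun h' => advance_owner
    simpa using this
  refine total_next_le ha ?_ ?_
  · intro j h _ _
    rw [e1]
    split_ifs
    · exact advance_content_le hi h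
    · exact le_rfl
  · intro j h _ _ hd
    have h1 := advance_content_le hi h.rest
    have h2 := steal_content_le hi hd
    rw [e1, h.loot_owner, show h.rest.owner = h.owner from rfl]
    split_ifs
    · omega
    · simp

/-- The forecast stays valid as time passes and as helpers are robbed. It can only fail when `o`
itself loses own work, since this work then counts as held by others; hence the last hypothesis. -/
theorem ownLeftover_next_le (hi : ℕ) {L H : ℕ} {s : State P} (hg : s.Good L H) {a : Attempts P}
    {w : Fin P → Fin P} (ha : a ∈ Fintype.piFinset (options s)) {o : Fin P} {T T' : ℕ}
    (hT : T ≤ T' + 1) (hh : ∀ h, s.holds o = some h → h.owner = o → ¬ Hit s a w o) :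
    ownLeftover hi (s.next a w) o T' ≤ ownLeftover hi s o T := by
  have e1 : ∀ (p : Fin P) (h : Holding P), h.advance.elim 0
      (fun h' => if p ≠ o ∧ h'.owner = o then h'.leftover hi T' else 0) =
      if p ≠ o ∧ h.owner = o then h.advance.elim 0 (Holding.leftover hi T') else 0 := fun p h =>
    elim_ite_owner o h.advance h (Holding.leftover hi T') (p ≠ o) fun h' => advance_owner
  refine total_next_le ha ?_ ?_
  · intro j h hj _
    rw [e1]
    split_ifs
    · exact advance_leftover_le hi hT (hg.holding j h hj).pos
    · exact le_rfl
  · intro j h hj hhit hd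
    have h1 := steal_leftover_le hi hT (hg.holding j h hj).pos hd
    rw [e1, h.loot_owner, show h.rest.owner = h.owner from rfl]
    by_cases ho : h.owner = o
    · have hne : j ≠ o := by rintro rfl; exact hh h hj ho hhit
      simp only [ho, hne, ne_eq, not_false_eq_true, and_self, if_true, and_true]
      split_ifs <;> omega
    · simp [ho]

theorem active_next_subset {L H : ℕ} {s : State P} (hg : s.Good L H) {a : Attempts P}
    {w : Fin P → Fin P} {o : Fin P} {T T' : ℕ} (hT : T ≤ T' + 1) :
    active (s.next a w) o T' ⊆ active s o T ∪ newHelpers s a w o := by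
  classical
  intro p hp
  obtain ⟨hl, hne, h', hh', ho', hd', hv'⟩ := Finset.mem_filter.1 hp
  have old : ∀ h, s.holds p = some h → h.owner = h'.owner → h.deque ≠ [] →
      h'.volume + 1 ≤ h.volume → p ∈ active s o T ∪ newHelpers s a w o := by
    intro h hh ho hd hv
    rcases Finset.mem_union.1 hl with hl | hl
    · exact Finset.mem_union_left _ (Finset.mem_filter.2 ⟨(Finset.mem_filter.1 hl).1, hne, h, hh,
        ho.trans ho', hd, by omega⟩)
    · exact Finset.mem_union_right _ hl
  rcases nextHolding_cases hh' with ⟨h, hh, -, ha⟩ | ⟨h, hh, -, hd, ha⟩ | ⟨j, h, hf, hs, hj, hd, rfl⟩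
  · have hv := advance_volume (hg.holding p h hh).pos
    rw [ha] at hv
    exact old h hh (advance_owner ha).symm (advance_deque_ne_nil ha hd') hv.le
  · have hv := advance_volume (h := h.rest) (hg.holding p h hh).pos
    have hv2 := rest_volume hd
    rw [ha] at hv
    simp only [Option.elim_some] at hv
    exact old h hh (show h'.owner = h.rest.owner from advance_owner ha).symm hd (by omega)
  · rw [h.loot_owner] at ho'
    refine Finset.mem_union_right _ (Finset.mem_filter.2 ⟨Finset.mem_univ _, hne, ?_, j, h, hs, hj, ho'⟩)
    by_contra hl
    obtain ⟨y, hy, -, ho⟩ := hs.1.2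
    rw [hj] at hy
    cases hy
    exact hne ((ho (Finset.nonempty_iff_ne_empty.2 hl)).symm.trans ho')

theorem ownTime_next_ge {L H : ℕ} {s : State P} (hg : s.Good L H) {a : Attempts P}
    {w : Fin P → Fin P} {o : Fin P}
    (hh : ∀ h, s.holds o = some h → h.owner = o → ¬ Hit s a w o) :
    ownTime s o ≤ ownTime (s.next a w) o + 1 := by
  classical
  unfold ownTime
  rcases ho : s.holds o with _ | h
  · exact Nat.zero_le _
  · by_cases hown : h.owner = o
    · have h1 : (s.next a w).holds o = h.advance := by
        simp only [State.next]
        rw [nextHolding_busy ho, if_neg (hh h ho hown)]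
      have h2 := advance_volume (hg.holding o h ho).pos
      rw [h1]
      rcases ha : h.advance with _ | h'
      · rw [ha] at h2
        simp only [Option.elim_some, Option.elim_none] at h2 ⊢
        split_ifs; omega
      · rw [ha] at h2
        simp only [Option.elim_some, advance_owner ha, hown, if_true] at h2 ⊢
        omega
    · simp [hown]

/-! ### The potential of an owner -/

/-- The logarithm of the content `X`, softened by the fraction `Q / X` that is not certain to be
completed soon. -/
noncomputable def softLog (X Q : ℕ) : ℝ := Real.log X + Q / X

/-- In `X` the derivative is `1 / X - Q / X ^ 2`, nonnegative for `Q ≤ X`: the decrease of the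
logarithm makes up for the growth of the fraction `Q / X` when content is used up. -/
theorem softLog_mono {X X' Q Q' : ℕ} (hX : X ≤ X') (hQ : Q ≤ Q') (hQX : Q ≤ X) :
    softLog X Q ≤ softLog X' Q' := by
  rcases Nat.eq_zero_or_pos X with rfl | hpos
  · have h1 : (0 : ℝ) ≤ Real.log X' := Real.log_natCast_nonneg X'
    simp only [softLog, Nat.cast_zero, Real.log_zero, div_zero, add_zero]
    positivity
  · have h0 : (0 : ℝ) < X := by exact_mod_cast hpos
    have h0' : (0 : ℝ) < X' := by exact_mod_cast lt_of_lt_of_le hpos hX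
    have hX1 : (X : ℝ) ≤ X' := by exact_mod_cast hX
    have hQ1 : (Q : ℝ) ≤ Q' := by exact_mod_cast hQ
    have hQX1 : (Q : ℝ) ≤ X := by exact_mod_cast hQX
    have h1 := Real.log_le_sub_one_of_pos (show (0 : ℝ) < X / X' by positivity)
    rw [Real.log_div h0.ne' h0'.ne'] at h1
    have h2 : (Q : ℝ) / X * (1 - X / X') ≤ 1 * (1 - X / X') :=
      mul_le_mul_of_nonneg_right ((div_le_one h0).2 hQX1)
        (by rw [sub_nonneg, div_le_one h0']; exact hX1)
    have h3 : (Q : ℝ) / X * (X / X') = Q / X' := by field_simp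
    have h4 : (Q : ℝ) / X' ≤ Q' / X' := div_le_div_of_nonneg_right hQ1 h0'.le
    unfold softLog
    rw [mul_sub, mul_one, h3] at h2
    linarith

theorem softLog_nonneg (X Q : ℕ) : 0 ≤ softLog X Q :=
  add_nonneg (Real.log_natCast_nonneg X) (by positivity)

theorem softLog_le_log_add_one {X Q : ℕ} (h : Q ≤ X) : softLog X Q ≤ Real.log X + 1 :=
  add_le_add_right (div_le_one_of_le₀ (by exact_mod_cast h) (Nat.cast_nonneg _)) _

/-- The potential of an owner. -/
noncomputable def ownPotential (μ : ℝ) (hi : ℕ) (s : State P) (o : Fin P) : ℝ :=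
  24 * μ * softLog (ownContent hi s o) (ownLeftover hi s o (ownTime s o)) +
    4 * ((s.helpers o).card + (active s o (ownTime s o)).card)

/-- The decrease of the potential of a free owner when it gets a branch of volume `T`. -/
noncomputable def gain (μ : ℝ) (hi : ℕ) (s : State P) (o : Fin P) (T : ℕ) : ℝ :=
  24 * μ * (((ownContent hi s o : ℝ) - ownLeftover hi s o T) / ownContent hi s o) +
    4 * ((active s o 0).card - (active s o T).card)

theorem gain_nonneg {μ : ℝ} (hμ : 0 ≤ μ) (hi : ℕ) (s : State P) (o : Fin P) (T : ℕ) :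
    0 ≤ gain μ hi s o T := by
  have h1 : (ownLeftover hi s o T : ℝ) ≤ ownContent hi s o := by
    exact_mod_cast ownLeftover_le_ownContent hi s o T
  have h2 : ((active s o T).card : ℝ) ≤ (active s o 0).card := by
    exact_mod_cast Finset.card_le_card (active_anti s o (Nat.zero_le T))
  have h3 : 0 ≤ ((ownContent hi s o : ℝ) - ownLeftover hi s o T) / ownContent hi s o :=
    div_nonneg (sub_nonneg.2 h1) (Nat.cast_nonneg _)
  unfold gain
  have : 0 ≤ ((active s o 0).card : ℝ) - (active s o T).card := sub_nonneg.2 h2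
  positivity

theorem gain_le {μ : ℝ} (hμ : 0 ≤ μ) (hi : ℕ) (s : State P) (o : Fin P) (T : ℕ) :
    gain μ hi s o T ≤ 24 * μ + 4 * (active s o 0).card := by
  have h3 : ((ownContent hi s o : ℝ) - ownLeftover hi s o T) / ownContent hi s o ≤ 1 := by
    refine div_le_one_of_le₀ ?_ (Nat.cast_nonneg _)
    have : (0 : ℝ) ≤ ownLeftover hi s o T := Nat.cast_nonneg _
    linarith
  have h4 := mul_le_mul_of_nonneg_left h3 (show 0 ≤ 24 * μ by positivity)
  have h5 : (0 : ℝ) ≤ (active s o T).card := Nat.cast_nonneg _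
  unfold gain
  linarith

/-- The horizon `T` is left open: it is the present `ownTime` in an ordinary step, and the volume of
the loot when `o` has just recovered a branch. -/
theorem ownPotential_next_le {μ : ℝ} (hμ : 0 ≤ μ) (hi : ℕ) {L H : ℕ} {s : State P}
    (hg : s.Good L H) {a : Attempts P} {w : Fin P → Fin P}
    (ha : a ∈ Fintype.piFinset (options s)) {o : Fin P} {T : ℕ}
    (hT : T ≤ ownTime (s.next a w) o + 1)
    (hh : ∀ h, s.holds o = some h → h.owner = o → ¬ Hit s a w o) :
    ownPotential μ hi (s.next a w) o ≤
      24 * μ * softLog (ownContent hi s o) (ownLeftover hi s o T) +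
        4 * ((nextHelpers s a w o).card + (active s o T).card) +
        4 * (newHelpers s a w o).card := by
  have h1 := softLog_mono (ownContent_next_le hi ha o (w := w))
    (ownLeftover_next_le hi hg ha hT hh) (ownLeftover_le_ownContent hi _ o _)
  have h2 := mul_le_mul_of_nonneg_left h1 (show 0 ≤ 24 * μ by positivity)
  have h3 : ((active (s.next a w) o (ownTime (s.next a w) o)).card : ℝ) ≤
      (active s o T).card + (newHelpers s a w o).card := by
    classical
    exact_mod_cast (Finset.card_le_card (active_next_subset hg hT)).trans (Finset.card_union_le _ _)
  have h4 : (s.next a w).helpers o = nextHelpers s a w o := rfl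
  unfold ownPotential
  rw [h4]
  linarith

/-- If `o` is robbed, its forecast is void. This costs at most the whole fraction `Q / X ≤ 1` and
the return of all holders to the active ones. -/
theorem ownPotential_next_le_of_hit {μ : ℝ} (hμ : 0 ≤ μ) (hi : ℕ) {L H : ℕ} {s : State P}
    (hg : s.Good L H) {a : Attempts P} {w : Fin P → Fin P}
    (ha : a ∈ Fintype.piFinset (options s)) (o : Fin P) :
    ownPotential μ hi (s.next a w) o ≤
      ownPotential μ hi s o + 8 * (newHelpers s a w o).card +
        (24 * μ + 4 * (holders s o).card) := by
  have h1 := softLog_mono (ownContent_next_le hi ha o (w := w))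
    (ownLeftover_le_ownContent hi (s.next a w) o (ownTime (s.next a w) o) |>.trans
      (ownContent_next_le hi ha o (w := w))) (ownLeftover_le_ownContent hi _ o _)
  have h2 := softLog_le_log_add_one (le_refl (ownContent hi s o))
  have h3 : Real.log (ownContent hi s o) ≤
      softLog (ownContent hi s o) (ownLeftover hi s o (ownTime s o)) :=
    le_add_of_nonneg_right (by positivity)
  have h4 := mul_le_mul_of_nonneg_left (h1.trans (h2.trans (add_le_add_left h3 1)))
    (show 0 ≤ 24 * μ by positivity)
  have h5 : ((active (s.next a w) o (ownTime (s.next a w) o)).card : ℝ) ≤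
      (holders s o).card + (newHelpers s a w o).card := by
    classical
    exact_mod_cast ((Finset.card_le_card (active_next_subset hg (Nat.zero_le _))).trans
      (Finset.card_union_le _ _)).trans
      (Nat.add_le_add_right (Finset.card_le_card (active_subset_holders s o 0)) _)
  have h6 : ((nextHelpers s a w o).card : ℝ) ≤
      (s.helpers o).card + (newHelpers s a w o).card := by
    exact_mod_cast card_nextHelpers_le s a w o
  have h7 : (s.next a w).helpers o = nextHelpers s a w o := rfl
  have h8 : (0 : ℝ) ≤ (active s o (ownTime s o)).card := Nat.cast_nonneg _
  unfold ownPotential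
  rw [h7]
  linarith

theorem ownPotential_next_le_of_not_hit {μ : ℝ} (hμ : 0 ≤ μ) (hi : ℕ) {L H : ℕ} {s : State P}
    (hg : s.Good L H) {a : Attempts P} {w : Fin P → Fin P}
    (ha : a ∈ Fintype.piFinset (options s)) {o : Fin P}
    (hh : ∀ h, s.holds o = some h → h.owner = o → ¬ Hit s a w o) :
    ownPotential μ hi (s.next a w) o ≤
      ownPotential μ hi s o + 8 * (newHelpers s a w o).card := by
  have h1 := ownPotential_next_le hμ hi hg ha (ownTime_next_ge hg hh) hh
  have h2 : ((nextHelpers s a w o).card : ℝ) ≤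
      (s.helpers o).card + (newHelpers s a w o).card := by
    exact_mod_cast card_nextHelpers_le s a w o
  unfold ownPotential at h1 ⊢
  linarith

theorem ownTime_of_free {s : State P} {o : Fin P} (ho : s.holds o = none) : ownTime s o = 0 := by
  simp [ownTime, ho]

theorem ownPotential_next_le_of_failure {μ : ℝ} (hμ : 0 ≤ μ) (hi : ℕ) {L H : ℕ} {s : State P}
    (hg : s.Good L H) {a : Attempts P} {w : Fin P → Fin P}
    (ha : a ∈ Fintype.piFinset (options s)) {o j : Fin P} (ho : o ∈ backers s)
    (hj : j ∈ s.helpers o) (hao : a o = some j) (hn : ¬ Stealable s o j) :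
    ownPotential μ hi (s.next a w) o ≤
      ownPotential μ hi s o + 8 * (newHelpers s a w o).card - 4 := by
  have hf := (mem_backers.1 ho).1
  have hh : ∀ h, s.holds o = some h → h.owner = o → ¬ Hit s a w o := by
    intro h hh; rw [hf] at hh; cases hh
  have h1 := ownPotential_next_le hμ hi hg ha (ownTime_next_ge hg hh) hh
  have h2 : ((nextHelpers s a w o).card : ℝ) + 1 ≤
      (s.helpers o).card + (newHelpers s a w o).card := by
    exact_mod_cast card_nextHelpers_le_of_failure ho hj hao hn
  unfold ownPotential at h1 ⊢
  linarith

theorem ownPotential_next_le_of_success {μ : ℝ} (hμ : 0 ≤ μ) (hi : ℕ) {L H : ℕ} {s : State P}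
    (hg : s.Good L H) {a : Attempts P} {w : Fin P → Fin P}
    (ha : a ∈ Fintype.piFinset (options s)) (hw : ValidWinners s a w) {o j : Fin P} {h : Holding P}
    (ho : o ∈ backers s) (hao : a o = some j) (hj : s.holds j = some h) (hd : h.deque ≠ [])
    (hown : h.owner = o) (hc : ∀ k ∈ general s, a k ≠ some j) :
    ownPotential μ hi (s.next a w) o ≤
      ownPotential μ hi s o + 8 * (newHelpers s a w o).card - gain μ hi s o h.loot.volume := by
  have hf := (mem_backers.1 ho).1
  have hhit : Hit s a w j := hw.hit ((eligible_backer_iff ho).2 ⟨hao, h, hj, hd, hown⟩)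
  -- Without general thieves at `j` the winner makes a steal-back, and only the owner can do so
  -- successfully.
  have hwin : w j = o := by
    have h1 := hhit.eligible
    have h2 := h1.free ha
    have h3 : (s.helpers (w j)).Nonempty := by
      by_contra hne
      exact hc (w j) (mem_general.2 ⟨h2, Finset.not_nonempty_iff_eq_empty.1 hne⟩) h1.1
    obtain ⟨-, y, hy, -, hyo⟩ := h1
    rw [hj] at hy
    cases hy
    exact (hyo h3).symm.trans hown
  have hs : Succeeds s a w o j := ⟨hwin ▸ hhit.eligible, hwin⟩
  have hnext : (s.next a w).holds o = some h.loot := nextHolding_success hf hj hs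
  have hT : h.loot.volume ≤ ownTime (s.next a w) o + 1 := by
    rw [ownTime, hnext]
    simp [h.loot_owner, hown]
  have hh : ∀ h, s.holds o = some h → h.owner = o → ¬ Hit s a w o := by
    intro h hh; rw [hf] at hh; cases hh
  have h1 := ownPotential_next_le hμ hi hg ha hT hh
  have h2 : ((nextHelpers s a w o).card : ℝ) ≤
      (s.helpers o).card + (newHelpers s a w o).card := by
    exact_mod_cast card_nextHelpers_le s a w o
  have h3 : softLog (ownContent hi s o) (ownLeftover hi s o h.loot.volume) =
      softLog (ownContent hi s o) (ownLeftover hi s o 0) -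
      (((ownContent hi s o : ℝ) - ownLeftover hi s o h.loot.volume) / ownContent hi s o) := by
    rw [ownLeftover_zero hf, softLog, softLog]
    ring
  rw [h3] at h1
  unfold ownPotential gain at *
  rw [ownTime_of_free hf]
  linarith

/-- If something is stolen from `o` while it works on its own work, it is in a general steal. -/
theorem exists_general_of_hit {s : State P} {a : Attempts P} {w : Fin P → Fin P}
    (ha : a ∈ Fintype.piFinset (options s)) {o : Fin P} {h : Holding P} (ho : s.holds o = some h)
    (hown : h.owner = o) (hh : Hit s a w o) : ∃ k ∈ general s, a k = some o := by
  have h1 := hh.eligible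
  have h2 := h1.free ha
  refine ⟨w o, mem_general.2 ⟨h2, ?_⟩, h1.1⟩
  by_contra hne
  obtain ⟨-, y, hy, -, hyo⟩ := h1
  rw [ho] at hy
  cases hy
  have h3 := (hyo (Finset.nonempty_iff_ne_empty.2 hne)).symm.trans hown
  rw [h3, ho] at h2
  cases h2

/-! ### The average gain of a steal-back -/

theorem mem_active_zero {L H : ℕ} {s : State P} (hg : s.Good L H) {o j : Fin P}
    (ho : s.holds o = none) : j ∈ active s o 0 ↔ j ∈ s.helpers o ∧ Stealable s o j := by
  classical
  constructor
  · intro hj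
    obtain ⟨hl, -, h, hh, hown, hd, -⟩ := Finset.mem_filter.1 hj
    exact ⟨hl, h, hh, hd, hown⟩
  · rintro ⟨hl, h, hh, hd, hown⟩
    refine Finset.mem_filter.2 ⟨hl, ?_, h, hh, hown, hd, ?_⟩
    · rintro rfl; rw [ho] at hh; cases hh
    · have := (hg.holding j h hh).pos
      unfold Holding.volume
      omega

/-- By the list invariant all stealable work of a free owner is in the hands of listed helpers;
holdings with an empty deque have content 0. -/
theorem ownContent_eq_sum_active {L H : ℕ} {s : State P} (hg : s.Good L H) {o : Fin P}
    (ho : s.holds o = none) (hi : ℕ) :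
    ownContent hi s o = ∑ j ∈ active s o 0, (s.holds j).elim 0 (Holding.content hi) := by
  unfold ownContent State.total
  symm
  rw [← Finset.sum_subset (Finset.subset_univ (active s o 0))]
  · refine Finset.sum_congr rfl fun j hj => ?_
    obtain ⟨-, h, hh, -, hown⟩ := (mem_active_zero hg ho).1 hj
    rw [hh]
    simp [hown]
  · intro j _ hj
    rcases hh : s.holds j with _ | h
    · rfl
    · simp only [Option.elim_some]
      split_ifs with hown
      · by_cases hd : h.deque = []
        · exact if_pos hd
        · exfalso
          refine hj ((mem_active_zero hg ho).2 ⟨?_, h, hh, hd, hown⟩)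
          rw [← hown]
          refine hg.listed j h hh hd ?_
          rintro rfl
          rw [hown, ho] at hh
          cases hh
      · rfl

/-- The number of exceptional tasks that `j` holds. -/
def exceptionsAt (lo hi : Fin P → ℕ) (s : State P) (j : Fin P) : ℕ :=
  (s.holds j).elim 0 fun h => h.exceptions (lo h.owner) (hi h.owner)

open Classical in
/-- What the attempt of the free owner `o` to steal back from `j` yields, if no one interferes. -/
noncomputable def stealValue (μ : ℝ) (lo hi : Fin P → ℕ) (s : State P) (o j : Fin P) : ℝ :=
  if Stealable s o j then
    gain μ (hi o) s o ((s.holds j).elim 0 fun h => h.loot.volume) + 12 * μ * exceptionsAt lo hi s j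
  else 4

theorem stealValue_nonneg {μ : ℝ} (hμ : 0 ≤ μ) (lo hi : Fin P → ℕ) (s : State P) (o j : Fin P) :
    0 ≤ stealValue μ lo hi s o j := by
  unfold stealValue
  split_ifs
  · exact add_nonneg (gain_nonneg hμ _ _ _ _) (by positivity)
  · norm_num

/-- The value of a victim is at least `2 * |C|` times its share of the content `X`, where `C` is the
set of active helpers without exceptional tasks. If more than half of the tasks in the topmost
branch are exceptional, their credit `12 * μ` each pays, as `|C| * lo ≤ X`. Otherwise the loot has
volume `T` at least `1 / (6 * μ)` of the content of the victim. The members of `C` either finish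
within `T` steps and leave `active`, at 4 each, or do `T` units of content, weighted by `24 * μ /
X`; the larger of the two groups has at least half of `C` and pays. The three coefficients of the
potential come from these three cases. -/
theorem le_stealValue {μ : ℝ} (hμ : 1 ≤ μ) {lo hi : Fin P → ℕ} {L H : ℕ} {s : State P}
    (hg : s.Good L H) {o : Fin P} (ho : s.holds o = none)
    (hhi : (hi o : ℝ) ≤ μ * lo o) {j : Fin P} (hj : j ∈ active s o 0) :
    2 * ((active s o 0).filter fun p => exceptionsAt lo hi s p = 0).card *
        (s.holds j).elim 0 (Holding.content (hi o)) ≤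
      stealValue μ lo hi s o j * ownContent (hi o) s o := by
  classical
  set C := (active s o 0).filter fun p => exceptionsAt lo hi s p = 0 with hC
  have hCsub : C ⊆ active s o 0 := Finset.filter_subset _ _
  obtain ⟨hjl, h, hh, hd, hown⟩ := (mem_active_zero hg ho).1 hj
  have hgood := hg.holding j h hh
  set X := ownContent (hi o) s o with hX
  have hsum := ownContent_eq_sum_active hg ho (hi o)
  rw [← hX] at hsum
  have hxX : h.content (hi o) ≤ X := by
    rw [hsum]
    have := Finset.single_le_sum (f := fun j => (s.holds j).elim 0 (Holding.content (hi o)))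
      (fun _ _ => Nat.zero_le _) hj
    simpa [hh] using this
  have hCmem : ∀ p ∈ C, ∃ y, s.holds p = some y ∧ y.deque ≠ [] ∧ y.owner = o ∧
      y.exceptions (lo o) (hi o) = 0 := by
    intro p hp
    obtain ⟨hp1, hp2⟩ := Finset.mem_filter.1 hp
    obtain ⟨-, y, hy, hyd, hyo⟩ := (mem_active_zero hg ho).1 hp1
    simp only [exceptionsAt, hy, Option.elim_some, hyo] at hp2
    exact ⟨y, hy, hyd, hyo, hp2⟩
  have hCX : C.card * lo o ≤ X := by
    rw [hsum]
    refine le_trans ?_ (Finset.sum_le_sum_of_subset (hCsub))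
    rw [← smul_eq_mul, ← Finset.sum_const]
    refine Finset.sum_le_sum fun p hp => ?_
    obtain ⟨y, hy, hyd, hyo, hye⟩ := hCmem p hp
    rw [hy]
    exact le_content hye hyd
  have hval : stealValue μ lo hi s o j = gain μ (hi o) s o h.loot.volume +
      12 * μ * h.exceptions (lo o) (hi o) := by
    rw [stealValue, if_pos ⟨h, hh, hd, hown⟩, exceptionsAt, hh]
    simp [hown]
  rw [hval, hh, Option.elim_some]
  have hgn := gain_nonneg (zero_le_one.trans hμ) (hi o) s o h.loot.volume
  have hexc : ((h.top.weight (exceptional (lo o) (hi o)) : ℕ) : ℝ) ≤ h.exceptions (lo o) (hi o) := by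
    exact_mod_cast top_exceptions_le (lo o) (hi o) hd
  have hcont : (h.content (hi o) : ℝ) ≤ 3 * h.top.sizes.length * (μ * lo o) := by
    have h1 : (h.content (hi o) : ℝ) ≤ 3 * h.top.sizes.length * hi o := by
      exact_mod_cast content_le_top (hi o) hgood hd
    exact h1.trans (mul_le_mul_of_nonneg_left hhi (by positivity))
  have hCX' : (C.card : ℝ) * lo o ≤ X := by exact_mod_cast hCX
  have hxX' : (h.content (hi o) : ℝ) ≤ X := by exact_mod_cast hxX
  have hX0 : (0 : ℝ) ≤ X := Nat.cast_nonneg _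
  have hC0 : (0 : ℝ) ≤ C.card := Nat.cast_nonneg _
  have hμ0 : 0 < μ := by linarith
  rcases lt_or_ge h.top.sizes.length (2 * h.top.weight (exceptional (lo o) (hi o))) with hn | hn
  · have hn' : (h.top.sizes.length : ℝ) ≤ 2 * h.top.weight (exceptional (lo o) (hi o)) := by
      exact_mod_cast hn.le
    have h1 : 2 * (C.card : ℝ) * h.content (hi o) ≤
        12 * μ * h.top.weight (exceptional (lo o) (hi o)) * (C.card * lo o) := by
      have h2 : (h.content (hi o) : ℝ) ≤
          6 * h.top.weight (exceptional (lo o) (hi o)) * (μ * lo o) := by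
        refine hcont.trans (mul_le_mul_of_nonneg_right ?_ (by positivity))
        linarith
      calc 2 * (C.card : ℝ) * h.content (hi o) ≤ 2 * C.card *
            (6 * h.top.weight (exceptional (lo o) (hi o)) * (μ * lo o)) :=
            mul_le_mul_of_nonneg_left h2 (by positivity)
        _ = _ := by ring
    have h3 : 12 * μ * (h.top.weight (exceptional (lo o) (hi o)) : ℝ) * (C.card * lo o) ≤
        12 * μ * h.exceptions (lo o) (hi o) * X := by
      gcongr
    have h4 : 0 ≤ gain μ (hi o) s o h.loot.volume * X := mul_nonneg hgn hX0
    linarith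
  · set T := h.loot.volume with hTdef
    have hT : T = h.top.weight fun s => s := loot_volume h
    have h0 : 0 ≤ 12 * μ * (h.exceptions (lo o) (hi o) : ℝ) * X := by positivity
    have hlT : (lo o : ℝ) * h.top.sizes.length ≤ 2 * T := by
      have h1 := top_weight_ge (lo o) (hi o) h.top
      rw [← hT] at h1
      have h2 := Nat.mul_le_mul_left (lo o) hn
      have h3 : lo o * (2 * h.top.weight (exceptional (lo o) (hi o))) =
        2 * (lo o * h.top.weight (exceptional (lo o) (hi o))) := by ring
      have h4 : lo o * h.top.sizes.length ≤ 2 * T := by omega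
      exact_mod_cast h4
    have hcT : (h.content (hi o) : ℝ) ≤ 6 * μ * T := by
      have h1 : (3 : ℝ) * h.top.sizes.length * (μ * lo o) =
        3 * μ * (lo o * h.top.sizes.length) := by ring
      have h2 := mul_le_mul_of_nonneg_left hlT (show 0 ≤ 3 * μ by positivity)
      linarith
    rcases Nat.eq_zero_or_pos X with hXz | hXpos
    · have h1 : h.content (hi o) = 0 := by omega
      rw [h1, hXz]
      simp
    have hXpos' : (0 : ℝ) < X := by exact_mod_cast hXpos
    have hgain : gain μ (hi o) s o T * X = 24 * μ * ((X : ℝ) - ownLeftover (hi o) s o T) +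
        4 * ((active s o 0).card - (active s o T).card) * X := by
      unfold gain
      rw [← hX]
      field_simp
    set sat := C.filter fun p => (s.holds p).elim 0 Holding.volume ≤ T with hsat
    set uns := C.filter fun p => ¬ (s.holds p).elim 0 Holding.volume ≤ T with huns
    have hcard : sat.card + uns.card = C.card := Finset.card_filter_add_card_filter_not _
    have hact : (active s o T).card + sat.card ≤ (active s o 0).card := by
      rw [← Finset.card_union_of_disjoint]
      · refine Finset.card_le_card (Finset.union_subset (active_anti s o (Nat.zero_le T)) ?_)
        exact fun p hp => (Finset.mem_filter.1 (Finset.mem_filter.1 hp).1).1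
      · rw [Finset.disjoint_left]
        intro p hp hp'
        obtain ⟨-, -, y, hy, -, -, hv⟩ := Finset.mem_filter.1 hp
        have h1 := (Finset.mem_filter.1 hp').2
        rw [hy] at h1
        simp only [Option.elim_some] at h1
        omega
    -- Without exceptional tasks content equals volume, so `T` units of work reduce the content by
    -- `T`. In other holdings the work might go into truncated parts, and nothing is claimed.
    have hleft : ownLeftover (hi o) s o T + uns.card * T ≤ X := by
      have h1 : uns.card * T = ∑ p, if p ∈ uns then T else 0 := by
        rw [Finset.sum_ite_mem, Finset.univ_inter, Finset.sum_const, smul_eq_mul]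
      rw [h1, hX, ownLeftover, ownContent, State.total, State.total, ← Finset.sum_add_distrib]
      refine Finset.sum_le_sum fun p _ => ?_
      split_ifs with hp
      · obtain ⟨hp1, hp2⟩ := Finset.mem_filter.1 hp
        obtain ⟨y, hy, hyd, hyo, hye⟩ := hCmem p hp1
        have hne : p ≠ o := by rintro rfl; rw [ho] at hy; cases hy
        rw [hy] at hp2 ⊢
        have hcv := content_eq_volume hye hyd
        simp only [Option.elim_some, hne, hyo, ne_eq, not_false_eq_true, and_self, if_true,
          Holding.leftover] at hp2 ⊢
        omega
      · rcases s.holds p with _ | y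
        · exact le_rfl
        · simp only [Option.elim_some, add_zero]
          split_ifs with h2 h3 h3
          · exact min_le_left _ _
          · exact absurd h2.2 h3
          · exact Nat.zero_le _
          · exact le_rfl
    have hact' : ((active s o T).card : ℝ) + sat.card ≤ (active s o 0).card := by exact_mod_cast hact
    have hleft' : (ownLeftover (hi o) s o T : ℝ) + uns.card * T ≤ X := by exact_mod_cast hleft
    have hcard' : (sat.card : ℝ) + uns.card = C.card := by exact_mod_cast hcard
    have hT0 : (0 : ℝ) ≤ T := Nat.cast_nonneg _
    have e1 : 24 * μ * (uns.card * T) ≤ 24 * μ * ((X : ℝ) - ownLeftover (hi o) s o T) :=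
      mul_le_mul_of_nonneg_left (by linarith) (by positivity)
    have e2 : 4 * (sat.card : ℝ) * X ≤
        4 * ((active s o 0).card - (active s o T).card) * X :=
      mul_le_mul_of_nonneg_right (by linarith) hX0
    have e3 : 0 ≤ 24 * μ * ((uns.card : ℝ) * T) := by positivity
    have e4 : 0 ≤ 4 * (sat.card : ℝ) * X := by positivity
    rw [add_mul, hgain]
    rcases le_total (C.card : ℝ) (2 * sat.card) with hs | hs
    · have e5 : 2 * (C.card : ℝ) * h.content (hi o) ≤ 2 * (2 * sat.card) * X := by gcongr
      linarith
    · have e5 : 2 * (C.card : ℝ) * h.content (hi o) ≤ 2 * (2 * uns.card) * (6 * μ * T) := by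
        have : (C.card : ℝ) ≤ 2 * uns.card := by linarith
        gcongr
      linarith

/-- Without interference, a steal-back from a uniform helper is worth at least 1 on average. Either
at least half of the list lies outside `C` and is worth 4 each, or `C` is at least half of the list
and summing `le_stealValue` over the shares, which add up to the whole content, gives `2 * |C|`. -/
theorem card_helpers_le_sum_stealValue {μ : ℝ} (hμ : 1 ≤ μ) {lo hi : Fin P → ℕ} {L H : ℕ}
    {s : State P} (hg : s.Good L H) {o : Fin P} (ho : o ∈ backers s) (hlo : 1 ≤ lo o)
    (hhi : (hi o : ℝ) ≤ μ * lo o) :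
    ((s.helpers o).card : ℝ) ≤ ∑ j ∈ s.helpers o, stealValue μ lo hi s o j := by
  classical
  obtain ⟨hf, hne⟩ := mem_backers.1 ho
  have hμ0 : 0 ≤ μ := by linarith
  set C := (active s o 0).filter fun p => exceptionsAt lo hi s p = 0 with hC
  have hCE : C ⊆ active s o 0 := Finset.filter_subset _ _
  have hEl : active s o 0 ⊆ s.helpers o := Finset.filter_subset _ _
  have hr : (0 : ℝ) < (s.helpers o).card := by exact_mod_cast Finset.card_pos.2 hne
  rcases le_total (2 * (C.card : ℝ)) (s.helpers o).card with hc | hc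
  · have h1 : ∀ j ∈ s.helpers o \ C, (4 : ℝ) ≤ stealValue μ lo hi s o j := by
      intro j hj
      obtain ⟨hjl, hjC⟩ := Finset.mem_sdiff.1 hj
      unfold stealValue
      split_ifs with hst
      · have h2 : exceptionsAt lo hi s j ≠ 0 := fun h0 =>
          hjC (Finset.mem_filter.2 ⟨(mem_active_zero hg hf).2 ⟨hjl, hst⟩, h0⟩)
        have h3 : (1 : ℝ) ≤ exceptionsAt lo hi s j := by
          exact_mod_cast Nat.one_le_iff_ne_zero.2 h2
        have h4 := gain_nonneg hμ0 (hi o) s o ((s.holds j).elim 0 fun h => h.loot.volume)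
        nlinarith
      · exact le_rfl
    have h2 : ∑ j ∈ s.helpers o \ C, stealValue μ lo hi s o j ≤
        ∑ j ∈ s.helpers o, stealValue μ lo hi s o j :=
      Finset.sum_le_sum_of_subset_of_nonneg Finset.sdiff_subset
        fun j _ _ => stealValue_nonneg hμ0 lo hi s o j
    have h3 := Finset.card_nsmul_le_sum _ _ _ h1
    rw [nsmul_eq_mul, Finset.card_sdiff_of_subset (hCE.trans hEl),
      Nat.cast_sub (Finset.card_le_card (hCE.trans hEl))] at h3
    linarith
  · have hCpos : 0 < C.card := by
      by_contra h0
      have : C.card = 0 := by omega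
      rw [this] at hc
      norm_num at hc
      exact hne.ne_empty hc
    have hsum := ownContent_eq_sum_active hg hf (hi o)
    have hXpos : 0 < ownContent (hi o) s o := by
      obtain ⟨p, hp⟩ := Finset.card_pos.1 hCpos
      obtain ⟨hp1, hp2⟩ := Finset.mem_filter.1 hp
      obtain ⟨-, y, hy, hyd, hyo⟩ := (mem_active_zero hg hf).1 hp1
      simp only [exceptionsAt, hy, Option.elim_some, hyo] at hp2
      have h1 := le_content hp2 hyd
      have h2 := Finset.single_le_sum (f := fun j => (s.holds j).elim 0 (Holding.content (hi o)))
        (fun _ _ => Nat.zero_le _) hp1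
      simp only [hy, Option.elim_some] at h2
      omega
    have hXpos' : (0 : ℝ) < ownContent (hi o) s o := by exact_mod_cast hXpos
    have h1 : 2 * (C.card : ℝ) * ownContent (hi o) s o ≤
        (∑ j ∈ active s o 0, stealValue μ lo hi s o j) * ownContent (hi o) s o := by
      conv_lhs => rw [hsum]
      rw [Nat.cast_sum, Finset.mul_sum, Finset.sum_mul]
      refine Finset.sum_le_sum fun j hj => ?_
      exact le_stealValue hμ hg hf hhi hj
    have h2 := le_of_mul_le_mul_right h1 hXpos'
    have h3 : ∑ j ∈ active s o 0, stealValue μ lo hi s o j ≤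
        ∑ j ∈ s.helpers o, stealValue μ lo hi s o j :=
      Finset.sum_le_sum_of_subset_of_nonneg hEl fun j _ _ => stealValue_nonneg hμ0 lo hi s o j
    linarith

/-! ### Paying for the steal-backs with the ratios of the task sizes -/

/-- The remaining exposure of exceptional tasks to steals. -/
noncomputable def State.exposure (lo hi : Fin P → ℕ) (s : State P) : ℝ :=
  s.total fun _ h => (h.exposure (lo h.owner) (hi h.owner) : ℝ)

open Classical in
theorem exposure_next_le (lo hi : Fin P → ℕ) {s : State P} {a : Attempts P} {w : Fin P → Fin P}
    (ha : a ∈ Fintype.piFinset (options s)) (hw : ValidWinners s a w) :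
    (s.next a w).exposure lo hi + ∑ o ∈ backers s, (a o).elim 0 (fun j =>
        if Stealable s o j then (exceptionsAt lo hi s j : ℝ) else 0) ≤ s.exposure lo hi := by
  have h1 : (s.next a w).exposure lo hi ≤ s.total fun j h =>
      (h.exposure (lo h.owner) (hi h.owner) : ℝ) -
        if Hit s a w j then (h.exceptions (lo h.owner) (hi h.owner) : ℝ) else 0 := by
    have e1 : ∀ h : Holding P, h.advance.elim 0
        (fun h' => (h'.exposure (lo h'.owner) (hi h'.owner) : ℝ)) =
        ((h.advance.elim 0 (Holding.exposure (lo h.owner) (hi h.owner)) : ℕ) : ℝ) := fun h => by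
      rcases ha : h.advance with _ | h'
      · simp
      · simp [advance_owner ha]
    refine total_next_le ha ?_ ?_
    · intro j h _ hh
      rw [e1, if_neg hh, sub_zero]
      exact_mod_cast advance_exposure_le _ _ h
    · intro j h _ hh hd
      rw [e1, if_pos hh, h.loot_owner, show h.rest.owner = h.owner from rfl, le_sub_iff_add_le]
      exact_mod_cast steal_exposure_le _ _ hd
  rw [State.total_sub] at h1
  have h2 := sum_stealBack_le hw
    (fun _ h => (h.exceptions (lo h.owner) (hi h.owner) : ℝ)) (fun _ _ => Nat.cast_nonneg _)
  have h3 : ∀ j, (s.holds j).elim 0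
      (fun h => (h.exceptions (lo h.owner) (hi h.owner) : ℝ)) = exceptionsAt lo hi s j := fun j =>
    elim_cast _ _
  simp only [h3] at h2
  have h4 : s.exposure lo hi = s.total fun _ h => (h.exposure (lo h.owner) (hi h.owner) : ℝ) := rfl
  linarith

/-- The number of general steal attempts on `j`. -/
noncomputable def attacks (s : State P) (a : Attempts P) (j : Fin P) : ℝ :=
  ∑ k ∈ general s, if a k = some j then (1 : ℝ) else 0

theorem attacks_nonneg (s : State P) (a : Attempts P) (j : Fin P) : 0 ≤ attacks s a j :=
  Finset.sum_nonneg fun _ _ => by split_ifs <;> norm_num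

theorem one_le_attacks {s : State P} {a : Attempts P} {j : Fin P}
    (h : ∃ k ∈ general s, a k = some j) : 1 ≤ attacks s a j := by
  obtain ⟨k, hk, hak⟩ := h
  have h1 : (if a k = some j then (1 : ℝ) else 0) ≤ attacks s a j :=
    Finset.single_le_sum (f := fun k => if a k = some j then (1 : ℝ) else 0)
      (fun _ _ => by split_ifs <;> norm_num) hk
  rwa [if_pos hak] at h1

open Classical in
/-- The gain of the steal-back of `o` from `j`, apart from that of exceptional tasks. -/
noncomputable def stealGain (μ : ℝ) (hi : Fin P → ℕ) (s : State P) (o j : Fin P) : ℝ :=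
  if Stealable s o j then gain μ (hi o) s o ((s.holds j).elim 0 fun h => h.loot.volume) else 4

open Classical in
/-- The gain that `o` loses if it attempts `x` and there is a general steal attempt on `j`. -/
noncomputable def lostGain (μ : ℝ) (hi : Fin P → ℕ) (s : State P) (o j : Fin P)
    (x : Option (Fin P)) : ℝ :=
  if x = some j ∧ Stealable s o j then
    gain μ (hi o) s o ((s.holds j).elim 0 fun h => h.loot.volume) else 0

/-- The gain that `o` loses to general steals. -/
noncomputable def totalLoss (μ : ℝ) (hi : Fin P → ℕ) (s : State P) (a : Attempts P)
    (o : Fin P) : ℝ :=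
  ∑ k ∈ general s, ∑ j ∈ busy s, lostGain μ hi s o j (a o) * if a k = some j then (1 : ℝ) else 0

theorem lostGain_nonneg {μ : ℝ} (hμ : 0 ≤ μ) (hi : Fin P → ℕ) (s : State P) (o j : Fin P)
    (x : Option (Fin P)) : 0 ≤ lostGain μ hi s o j x := by
  unfold lostGain
  split_ifs
  · exact gain_nonneg hμ _ _ _ _
  · exact le_rfl

theorem lostGain_term_nonneg {μ : ℝ} (hμ : 0 ≤ μ) (hi : Fin P → ℕ) (s : State P) (a : Attempts P)
    (o j k : Fin P) : 0 ≤ lostGain μ hi s o j (a o) * if a k = some j then (1 : ℝ) else 0 :=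
  mul_nonneg (lostGain_nonneg hμ _ _ _ _ _) (by split_ifs <;> norm_num)

theorem totalLoss_nonneg {μ : ℝ} (hμ : 0 ≤ μ) (hi : Fin P → ℕ) (s : State P) (a : Attempts P)
    (o : Fin P) : 0 ≤ totalLoss μ hi s a o :=
  Finset.sum_nonneg fun k _ => Finset.sum_nonneg fun j _ => lostGain_term_nonneg hμ hi s a o j k

theorem gain_le_totalLoss {μ : ℝ} (hμ : 0 ≤ μ) (hi : Fin P → ℕ) {s : State P} {a : Attempts P}
    {o j : Fin P} (hao : a o = some j) (hst : Stealable s o j)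
    (hk : ∃ k ∈ general s, a k = some j) :
    gain μ (hi o) s o ((s.holds j).elim 0 fun h => h.loot.volume) ≤ totalLoss μ hi s a o := by
  obtain ⟨k, hk, hak⟩ := hk
  obtain ⟨h, hh, -⟩ := id hst
  have h1 := Finset.single_le_sum (f := fun k => ∑ j ∈ busy s, lostGain μ hi s o j (a o) *
    if a k = some j then (1 : ℝ) else 0)
    (fun k _ => Finset.sum_nonneg fun j _ => lostGain_term_nonneg hμ hi s a o j k) hk
  have h2 := Finset.single_le_sum (f := fun j => lostGain μ hi s o j (a o) *
    if a k = some j then (1 : ℝ) else 0)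
    (fun j _ => lostGain_term_nonneg hμ hi s a o j k) (mem_busy.2 ⟨h, hh⟩)
  refine le_trans (le_of_eq ?_) (h2.trans h1)
  simp [lostGain, hao, hst, hak]

-- The three sources of increase are new helpers, thefts from an owner busy with its own work, and
-- gains of steal-backs thwarted by a general thief at the same victim. All three are due to general
-- steals.
open Classical in
theorem ownPotential_step {μ : ℝ} (hμ : 0 ≤ μ) (hi : Fin P → ℕ) {L H : ℕ} {s : State P}
    (hg : s.Good L H) {a : Attempts P} {w : Fin P → Fin P}
    (ha : a ∈ Fintype.piFinset (options s)) (hw : ValidWinners s a w) (o : Fin P) :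
    ownPotential μ (hi o) (s.next a w) o ≤
      ownPotential μ (hi o) s o + 8 * (newHelpers s a w o).card +
        (if o ∈ busy s then (24 * μ + 4 * (holders s o).card) * attacks s a o else 0) +
        (if o ∈ backers s then totalLoss μ hi s a o - (a o).elim 0 (stealGain μ hi s o) else 0) := by
  by_cases hb : o ∈ busy s
  · have hnb : o ∉ backers s := fun h => by
      obtain ⟨y, hy⟩ := mem_busy.1 hb
      rw [(mem_backers.1 h).1] at hy
      cases hy
    have h0 : 0 ≤ 24 * μ + 4 * ((holders s o).card : ℝ) := by positivity
    rw [if_pos hb, if_neg hnb, add_zero]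
    by_cases hh : ∃ h, s.holds o = some h ∧ h.owner = o ∧ Hit s a w o
    · obtain ⟨h, hho, hown, hhit⟩ := hh
      have h1 := ownPotential_next_le_of_hit hμ (hi o) hg ha o (w := w)
      have h2 := mul_le_mul_of_nonneg_left
        (one_le_attacks (exists_general_of_hit ha hho hown hhit)) h0
      linarith
    · push Not at hh
      have h1 := ownPotential_next_le_of_not_hit hμ (hi o) hg ha hh
      have h2 := mul_nonneg h0 (attacks_nonneg s a o)
      linarith
  · have hf : s.holds o = none := by
      by_contra hne
      obtain ⟨y, hy⟩ := Option.ne_none_iff_exists'.1 hne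
      exact hb (mem_busy.2 ⟨y, hy⟩)
    have hh : ∀ h, s.holds o = some h → h.owner = o → ¬ Hit s a w o := by
      intro h hh; rw [hf] at hh; cases hh
    have h1 := ownPotential_next_le_of_not_hit hμ (hi o) hg ha hh
    rw [if_neg hb, add_zero]
    by_cases hob : o ∈ backers s
    · rw [if_pos hob]
      obtain ⟨j, hj, hao⟩ := exists_attempt_of_backer ha hob
      have h2 := totalLoss_nonneg hμ hi s a o
      rw [hao, Option.elim_some, stealGain]
      split_ifs with hst
      · by_cases hk : ∃ k ∈ general s, a k = some j
        · have h3 := gain_le_totalLoss hμ hi hao hst hk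
          linarith
        · push Not at hk
          obtain ⟨h, hhj, hd, hown⟩ := hst
          have h3 := ownPotential_next_le_of_success hμ (hi o) hg ha hw hob hao hhj hd hown hk
          rw [hhj, Option.elim_some]
          linarith
      · have h3 := ownPotential_next_le_of_failure hμ (hi o) hg ha hob hj hao hst (w := w)
        linarith
    · rw [if_neg hob]
      linarith

theorem avg_attacks {s : State P} {o : Fin P} (ho : o ∈ busy s) :
    avg s (fun a => attacks s a o) = (general s).card * (1 / (busy s).card) := by
  simp only [attacks]
  rw [avg, piAvg_sum, Finset.sum_congr rfl fun k hk => avg_general ⟨o, ho⟩ hk ho,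
    Finset.sum_const, nsmul_eq_mul]

/-- A given general thief meets the victim of `o` with probability `1 / busy`, independently of the
choice of `o`. With `E` active helpers among `r` listed ones, the expected gain at stake is at most
`(E / r) * (24 * μ + 4 * E) ≤ (24 * μ + 4) * E`, as `E ≤ r` and `r ≥ 1`. -/
theorem avg_totalLoss_le {μ : ℝ} (hμ : 0 ≤ μ) (hi : Fin P → ℕ) {L H : ℕ} {s : State P}
    (hg : s.Good L H) (hb : (busy s).Nonempty) {o : Fin P} (ho : o ∈ backers s) :
    avg s (fun a => totalLoss μ hi s a o) ≤
      (general s).card * (1 / (busy s).card) * ((24 * μ + 4) * (active s o 0).card) := by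
  classical
  obtain ⟨hf, hne⟩ := mem_backers.1 ho
  have hr : (1 : ℝ) ≤ (s.helpers o).card := by exact_mod_cast Finset.card_pos.2 hne
  have hsub : active s o 0 ⊆ s.helpers o := Finset.filter_subset _ _
  have hEl : ((active s o 0).card : ℝ) ≤ (s.helpers o).card := by
    exact_mod_cast Finset.card_le_card hsub
  have hE0 : (0 : ℝ) ≤ (active s o 0).card := Nat.cast_nonneg _
  simp only [totalLoss]
  rw [avg, piAvg_sum]
  simp only [piAvg_sum]
  have h1 : ∀ k ∈ general s, ∑ j ∈ busy s, piAvg (options s)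
      (fun a => lostGain μ hi s o j (a o) * if a k = some j then (1 : ℝ) else 0) ≤
      1 / (busy s).card * ((24 * μ + 4) * (active s o 0).card) := by
    intro k hk
    have e1 : ∀ j ∈ busy s, piAvg (options s)
        (fun a => lostGain μ hi s o j (a o) * if a k = some j then (1 : ℝ) else 0) =
        (∑ j' ∈ s.helpers o, lostGain μ hi s o j (some j')) / (s.helpers o).card *
          (1 / (busy s).card) := fun j hj =>
      avg_backer_general hb ho hk hj (lostGain μ hi s o j)
    rw [Finset.sum_congr rfl e1, ← Finset.sum_mul, ← Finset.sum_div, Finset.sum_comm, mul_comm]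
    refine mul_le_mul_of_nonneg_left ?_ (by positivity)
    have e2 : ∀ j' ∈ s.helpers o, ∑ j ∈ busy s, lostGain μ hi s o j (some j') ≤
        if j' ∈ active s o 0 then 24 * μ + 4 * ((active s o 0).card : ℝ) else 0 := by
      intro j' hj'
      have e3 : ∀ j, lostGain μ hi s o j (some j') = if j = j' then
          (if j' ∈ active s o 0 then
            gain μ (hi o) s o ((s.holds j').elim 0 fun h => h.loot.volume) else 0) else 0 := by
        intro j
        rw [lostGain]
        by_cases hjj : j = j'
        · subst hjj
          simp [mem_active_zero hg hf, hj']
        · have : j' ≠ j := fun h => hjj h.symm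
          simp [hjj, this]
      simp only [e3]
      rw [Finset.sum_ite_eq' (busy s) j']
      split_ifs
      · exact gain_le hμ _ _ _ _
      · exact le_rfl
      · positivity
      · exact le_rfl
    have e4 := Finset.sum_le_sum e2
    rw [← Finset.sum_filter, Finset.sum_const, nsmul_eq_mul,
      Finset.filter_mem_eq_inter, Finset.inter_eq_right.2 hsub] at e4
    rw [div_le_iff₀ (by linarith)]
    refine e4.trans ?_
    have e5 : ((active s o 0).card : ℝ) * (active s o 0).card ≤
        (active s o 0).card * (s.helpers o).card := mul_le_mul_of_nonneg_left hEl hE0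
    have e6 : 24 * μ * ((active s o 0).card : ℝ) * 1 ≤
        24 * μ * (active s o 0).card * (s.helpers o).card :=
      mul_le_mul_of_nonneg_left hr (by positivity)
    linarith
  refine (Finset.sum_le_sum h1).trans (le_of_eq ?_)
  rw [Finset.sum_const, nsmul_eq_mul, mul_assoc]

/-- The number of steal-backs that the present state can still pay for. -/
noncomputable def State.ratioPotential (μ : ℝ) (lo hi : Fin P → ℕ) (s : State P) : ℝ :=
  ∑ o, ownPotential μ (hi o) s o + 12 * μ * s.exposure lo hi

theorem ratioPotential_nonneg {μ : ℝ} (hμ : 0 ≤ μ) (lo hi : Fin P → ℕ) (s : State P) :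
    0 ≤ s.ratioPotential μ lo hi := by
  refine add_nonneg (Finset.sum_nonneg fun o _ => ?_) (mul_nonneg (by positivity)
    (State.total_nonneg fun _ _ _ => Nat.cast_nonneg _))
  have := softLog_nonneg (ownContent (hi o) s o) (ownLeftover (hi o) s o (ownTime s o))
  unfold ownPotential
  positivity

/-- The cost per general steal is 8 for a new helper and twice `24 * μ + 4`, for robbed owners and
for thwarted steal-backs. The last two are averages over uniform busy victims; they stay bounded
because every busy processor holds work of a single owner, so that the numbers of holders sum to the
number of busy processors. -/
theorem ratioPotential_drift {μ : ℝ} (hμ : 1 ≤ μ) {lo hi : Fin P → ℕ} (hlo : ∀ o, 1 ≤ lo o)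
    (hhi : ∀ o, (hi o : ℝ) ≤ μ * lo o) {L H : ℕ} {s : State P} (hg : s.Good L H)
    (hf : ¬ s.Finished) :
    ∃ U : Attempts P → ℝ,
      (∀ a ∈ Fintype.piFinset (options s), ∀ w, ValidWinners s a w →
        (s.next a w).ratioPotential μ lo hi ≤ U a) ∧
      avg s U ≤ s.ratioPotential μ lo hi - (backers s).card +
        (16 + 48 * μ) * (general s).card := by
  classical
  have hμ0 : 0 ≤ μ := by linarith
  have hb := busy_nonempty hf
  refine ⟨fun a => (s.ratioPotential μ lo hi + 8 * (general s).card) +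
    ∑ o ∈ busy s, (24 * μ + 4 * (holders s o).card) * attacks s a o +
    ∑ o ∈ backers s, totalLoss μ hi s a o -
    ∑ o ∈ backers s, (a o).elim 0 (stealValue μ lo hi s o), ?_, ?_⟩
  · intro a ha w hw
    have h1 := Finset.sum_le_sum fun o (_ : o ∈ Finset.univ) =>
      ownPotential_step hμ0 hi hg ha hw o
    have h2 := exposure_next_le lo hi ha hw
    have h3 : ∑ o, ((newHelpers s a w o).card : ℝ) ≤ (general s).card := by
      exact_mod_cast sum_card_newHelpers_le (w := w) ha
    simp only [Finset.sum_add_distrib] at h1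
    rw [Finset.sum_ite_mem, Finset.sum_ite_mem, Finset.univ_inter, Finset.univ_inter,
      Finset.sum_sub_distrib, ← Finset.mul_sum] at h1
    have h4 : ∑ o ∈ backers s, (a o).elim 0 (stealValue μ lo hi s o) =
        ∑ o ∈ backers s, (a o).elim 0 (stealGain μ hi s o) +
        12 * μ * ∑ o ∈ backers s, (a o).elim 0 (fun j =>
          if Stealable s o j then (exceptionsAt lo hi s j : ℝ) else 0) := by
      rw [Finset.mul_sum, ← Finset.sum_add_distrib]
      refine Finset.sum_congr rfl fun o _ => ?_
      rcases a o with _ | j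
      · simp
      · simp only [Option.elim_some, stealValue, stealGain]
        split_ifs <;> simp
    have h5 := mul_le_mul_of_nonneg_left h2 (show 0 ≤ 12 * μ by positivity)
    simp only [State.ratioPotential]
    rw [h4]
    linarith
  · rw [avg, piAvg_sub, piAvg_add, piAvg_add, piAvg_const (options_nonempty s), piAvg_sum,
      piAvg_sum, piAvg_sum]
    have hB : (0 : ℝ) < (busy s).card := by exact_mod_cast Finset.card_pos.2 hb
    have hg0 : (0 : ℝ) ≤ (general s).card := Nat.cast_nonneg _
    have hold : ∑ o, ((holders s o).card : ℝ) = (busy s).card := by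
      exact_mod_cast sum_card_holders s
    have hsub : ∀ t : Finset (Fin P), ∑ o ∈ t, ((holders s o).card : ℝ) ≤ (busy s).card := by
      intro t
      rw [← hold]
      exact Finset.sum_le_sum_of_subset_of_nonneg (Finset.subset_univ _)
        fun _ _ _ => Nat.cast_nonneg _
    have h1 : ∑ o ∈ busy s, piAvg (options s)
        (fun a => (24 * μ + 4 * (holders s o).card) * attacks s a o) ≤
        (24 * μ + 4) * (general s).card := by
      have e1 : ∀ o ∈ busy s, piAvg (options s)
          (fun a => (24 * μ + 4 * (holders s o).card) * attacks s a o) =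
          (24 * μ + 4 * (holders s o).card) * ((general s).card * (1 / (busy s).card)) :=
        fun o ho => by
          rw [piAvg_const_mul]
          congr 1
          exact avg_attacks ho
      rw [Finset.sum_congr rfl e1, ← Finset.sum_mul, Finset.sum_add_distrib, Finset.sum_const,
        nsmul_eq_mul, ← Finset.mul_sum]
      have e2 : ((busy s).card : ℝ) * (24 * μ) + 4 * ∑ o ∈ busy s, ((holders s o).card : ℝ) ≤
          (24 * μ + 4) * (busy s).card := by
        have := hsub (busy s)
        linarith
      refine (mul_le_mul_of_nonneg_right e2 (by positivity)).trans (le_of_eq ?_)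
      field_simp
    have h2 : ∑ o ∈ backers s, piAvg (options s) (fun a => totalLoss μ hi s a o) ≤
        (24 * μ + 4) * (general s).card := by
      have e1 := Finset.sum_le_sum fun o (ho : o ∈ backers s) => avg_totalLoss_le hμ0 hi hg hb ho
      refine e1.trans ?_
      rw [← Finset.mul_sum, ← Finset.mul_sum]
      have e2 : ∑ o ∈ backers s, ((active s o 0).card : ℝ) ≤ (busy s).card :=
        (Finset.sum_le_sum fun o _ => by
          exact_mod_cast Finset.card_le_card (active_subset_holders s o 0)).trans (hsub (backers s))
      have e3 := mul_le_mul_of_nonneg_left (mul_le_mul_of_nonneg_left e2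
        (show 0 ≤ 24 * μ + 4 by positivity))
        (show 0 ≤ ((general s).card : ℝ) * (1 / (busy s).card) by positivity)
      refine e3.trans (le_of_eq ?_)
      field_simp
    have h3 : ((backers s).card : ℝ) ≤ ∑ o ∈ backers s, piAvg (options s)
        (fun a => (a o).elim 0 (stealValue μ lo hi s o)) := by
      rw [← mul_one ((backers s).card : ℝ), ← nsmul_eq_mul]
      refine Finset.card_nsmul_le_sum _ _ _ fun o ho => ?_
      have e1 := avg_backer ho fun x => x.elim 0 (stealValue μ lo hi s o)
      have e2 : (0 : ℝ) < (s.helpers o).card := by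
        exact_mod_cast Finset.card_pos.2 (mem_backers.1 ho).2
      rw [avg] at e1
      rw [e1, le_div_iff₀ e2, one_mul]
      exact card_helpers_le_sum_stealValue hμ hg ho (hlo o) (hhi o)
    linarith

/-! ### The initial value of the potential -/

/-- The lists are empty and the content is at most `L * 2 ^ T∞'` with `L` the largest task, so only
a logarithm of order `L + T∞'` remains. -/
theorem initial_ownPotential_le {μ : ℝ} (hμ : 0 ≤ μ) (hi : ℕ) (W : Workload P)
    (hH : 1 ≤ W.treeHeight) (o : Fin P) :
    ownPotential μ hi (State.initial W) o ≤ 48 * μ * W.span := by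
  have h1 : (State.initial W).helpers o = ∅ := rfl
  have h2 : active (State.initial W) o (ownTime (State.initial W) o) = ∅ :=
    Finset.subset_empty.1 (Finset.filter_subset _ _)
  have h3 : ownContent hi (State.initial W) o ≤ W.largestTask * 2 ^ W.treeHeight := by
    rw [ownContent, State.total, Finset.sum_eq_single o]
    · simp only [State.initial]
      rcases ht : W.tree o with _ | t
      · simp
      · simp only [Option.map_some, Option.elim_some, start_owner, if_true]
        refine (start_content_le hi o t []).trans ?_
        have e1 : t.weight (fun s => min s hi) ≤ t.weight fun _ => W.largestTask * 1 :=
          TaskTree.weight_mono _ fun s hs => (min_le_left _ _).trans (by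
            rw [mul_one]
            exact Workload.le_largestTask (by rwa [Workload.sizes_of_tree ht]))
        rw [TaskTree.weight_mul _ fun _ => 1, ← TaskTree.length_sizes] at e1
        rw [dequeWeight_nil, add_zero]
        exact e1.trans (Nat.mul_le_mul_left _ (t.length_sizes_le.trans
          (Nat.pow_le_pow_right (by norm_num) (Workload.height_le ht))))
    · intro p _ hne
      simp only [State.initial]
      rcases W.tree p with _ | t
      · rfl
      · simp [start_owner, hne]
    · simp
  have h4 : Real.log (ownContent hi (State.initial W) o) + 1 ≤ 2 * W.span := by
    have hs : (W.treeHeight : ℝ) + W.largestTask ≤ W.span := by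
      have : W.treeHeight + W.largestTask ≤ W.span := by unfold Workload.span; omega
      exact_mod_cast this
    have hH' : (1 : ℝ) ≤ W.treeHeight := by exact_mod_cast hH
    have hL : (0 : ℝ) ≤ W.largestTask := Nat.cast_nonneg _
    rcases Nat.eq_zero_or_pos (ownContent hi (State.initial W) o) with h0 | h0
    · rw [h0]
      simp only [Nat.cast_zero, Real.log_zero]
      linarith
    · have hLpos : 0 < W.largestTask := by
        by_contra hz
        have : W.largestTask = 0 := by omega
        rw [this] at h3
        omega
      have hL' : (0 : ℝ) < W.largestTask := by exact_mod_cast hLpos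
      have e1 : (ownContent hi (State.initial W) o : ℝ) ≤ W.largestTask * 2 ^ W.treeHeight := by
        exact_mod_cast h3
      have e2 := Real.log_le_log (by exact_mod_cast h0) e1
      rw [Real.log_mul hL'.ne' (by positivity), Real.log_pow] at e2
      have e3 := Real.log_le_sub_one_of_pos hL'
      have e4 := Real.log_le_sub_one_of_pos (show (0 : ℝ) < 2 by norm_num)
      have e5 := mul_le_mul_of_nonneg_left e4 (show (0 : ℝ) ≤ W.treeHeight by positivity)
      linarith
  have h5 := softLog_le_log_add_one (ownLeftover_le_ownContent hi (State.initial W) o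
    (ownTime (State.initial W) o))
  have h6 := mul_le_mul_of_nonneg_left (h5.trans h4) (show 0 ≤ 24 * μ by positivity)
  rw [ownPotential, h1, h2]
  simp only [Finset.card_empty, Nat.cast_zero, add_zero, mul_zero]
  linarith

theorem initial_exposure_le (lo hi : Fin P → ℕ) (W : Workload P) :
    (State.initial W).exposure lo hi ≤
      (∑ x : W.Task, exceptional (lo x.1) (hi x.1) (W.taskSize x) : ℕ) * W.treeHeight := by
  rw [sum_taskSize W fun i n => exceptional (lo i) (hi i) n, Nat.cast_sum, Finset.sum_mul,
    State.exposure, State.total]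
  refine Finset.sum_le_sum fun p _ => ?_
  simp only [State.initial]
  rcases ht : W.tree p with _ | t
  · simp only [Option.map_none, Option.elim_none]
    positivity
  · simp only [Option.map_some, Option.elim_some, start_owner]
    have e1 := start_exposure_le (lo p) (hi p) p t []
    simp only [List.length_nil, add_zero, dequeExposure] at e1
    rw [Workload.sizes_of_tree ht]
    exact_mod_cast e1.trans (Nat.mul_le_mul_left _ (Workload.height_le ht))

/-! ### The ratios of a workload -/

open Classical in
/-- The size of the smallest remaining task of `o`. -/
noncomputable def smallest (W : Workload P) (R : Finset W.Task) (o : Fin P) : ℕ :=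
  if h : (W.remainingSizes R o).Nonempty then (W.remainingSizes R o).min' h else 1

open Classical in
/-- The size of the largest remaining task of `o`. -/
noncomputable def largest (W : Workload P) (R : Finset W.Task) (o : Fin P) : ℕ :=
  if h : (W.remainingSizes R o).Nonempty then (W.remainingSizes R o).max' h else 0

theorem Workload.taskSize_pos (W : Workload P) (x : W.Task) : 1 ≤ W.taskSize x := by
  rcases ht : W.tree x.1 with _ | t
  · have h1 : (x.2 : ℕ) < (W.sizes x.1).length := x.2.2
    have h2 : (W.sizes x.1).length = 0 := congrArg List.length (Workload.sizes_of_none ht)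
    omega
  · refine W.size_pos x.1 t ht _ ?_
    rw [← Workload.sizes_of_tree ht]
    exact List.get_mem _ _

theorem one_le_smallest (W : Workload P) (R : Finset W.Task) (o : Fin P) :
    1 ≤ smallest W R o := by
  unfold smallest
  split_ifs with h
  · have h1 := Finset.min'_mem _ h
    simp only [Workload.remainingSizes, Finset.mem_image] at h1
    obtain ⟨x, -, hx⟩ := h1
    have h2 := W.taskSize_pos x
    rw [hx] at h2
    exact h2
  · exact le_rfl

theorem one_le_ratio (W : Workload P) (R : Finset W.Task) (o : Fin P) : 1 ≤ W.ratio R o := by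
  have h0 := one_le_smallest W R o
  unfold smallest at h0
  unfold Workload.ratio
  split_ifs with h
  · rw [dif_pos h] at h0
    rw [one_le_div (by exact_mod_cast h0)]
    exact_mod_cast Finset.min'_le_max' _ h
  · exact le_rfl

theorem ratio_le_maxRatio (W : Workload P) (R : Finset W.Task) (o : Fin P) :
    W.ratio R o ≤ W.maxRatio R := le_ciSup (Set.finite_range (W.ratio R)).bddAbove o

theorem largest_le (W : Workload P) (R : Finset W.Task) (o : Fin P) :
    (largest W R o : ℝ) ≤ W.maxRatio R * smallest W R o := by
  have h0 : (0 : ℝ) < smallest W R o := by exact_mod_cast one_le_smallest W R o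
  have h1 : (largest W R o : ℝ) ≤ W.ratio R o * smallest W R o := by
    rw [← div_le_iff₀ h0]
    unfold largest smallest Workload.ratio
    split_ifs with h <;> simp
  exact h1.trans (mul_le_mul_of_nonneg_right (ratio_le_maxRatio W R o) h0.le)

/-- A remaining task lies between the smallest and the largest one of its owner, so only removed
tasks can be exceptional. -/
theorem sum_exceptional_le (W : Workload P) (R : Finset W.Task) :
    ∑ x : W.Task, exceptional (smallest W R x.1) (largest W R x.1) (W.taskSize x) ≤ R.card := by
  classical
  rw [Finset.card_eq_sum_ones, ← Finset.sum_subset (Finset.subset_univ R)]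
  · refine Finset.sum_le_sum fun x _ => ?_
    unfold exceptional
    split_ifs <;> omega
  · intro x _ hx
    have h1 : W.taskSize x ∈ W.remainingSizes R x.1 :=
      Finset.mem_image.2 ⟨x, Finset.mem_filter.2 ⟨Finset.mem_univ _, rfl, hx⟩, rfl⟩
    have h2 : (W.remainingSizes R x.1).Nonempty := ⟨_, h1⟩
    rw [exceptional, if_pos]
    rw [smallest, largest, dif_pos h2, dif_pos h2]
    exact ⟨Finset.min'_le _ _ h1, Finset.le_max' _ _ h1⟩

/-- With `β = 16 + 48 * μ` the general steals cost `612 + 1728 * μ` spans. The initial value of the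
third potential, divided by `P`, is at most `(48 + 12 * c) * μ` spans. Since `μ ≥ 1`, the constant
is `612 + 1728 + 48 + 12 * c`. -/
theorem expectedTime_le_ratio (σ : ContentionRule P) (W : Workload P) (hP : 0 < P)
    (hH : 1 ≤ W.treeHeight) (R : Finset W.Task) {c : ℝ} (hc : 0 ≤ c) (hR : (R.card : ℝ) ≤ c * P) :
    expectedTime σ W ≤ ENNReal.ofReal
      ((W.work : ℝ) / P + (2388 + 12 * c) * (W.span * W.maxRatio R)) := by
  set μ := W.maxRatio R with hμdef
  have hμ : 1 ≤ μ := (one_le_ratio W R ⟨0, hP⟩).trans (ratio_le_maxRatio W R _)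
  have hμ0 : 0 ≤ μ := by linarith
  have hP' : (0 : ℝ) < P := by exact_mod_cast hP
  have h0 := expectedTime_le_of_stealBacks σ W hP hH
    (State.ratioPotential μ (smallest W R) (largest W R)) (β := 16 + 48 * μ) (by positivity)
    (ratioPotential_nonneg hμ0 _ _)
    (fun s hs hf => ratioPotential_drift hμ (one_le_smallest W R) (largest_le W R) hs hf)
  refine h0.trans (ENNReal.ofReal_le_ofReal ?_)
  have hs0 : (0 : ℝ) ≤ W.span := Nat.cast_nonneg _
  have h1 : (State.initial W).ratioPotential μ (smallest W R) (largest W R) ≤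
      (48 + 12 * c) * (W.span * μ) * P := by
    have e1 := Finset.sum_le_sum fun o (_ : o ∈ Finset.univ) =>
      initial_ownPotential_le hμ0 (largest W R o) W hH o
    rw [Finset.sum_const, Finset.card_univ, Fintype.card_fin, nsmul_eq_mul] at e1
    have e2 := initial_exposure_le (smallest W R) (largest W R) W
    have e3 : ((∑ x : W.Task, exceptional (smallest W R x.1) (largest W R x.1) (W.taskSize x) : ℕ) : ℝ)
        ≤ c * P := le_trans (by exact_mod_cast sum_exceptional_le W R) hR
    have e4 : (W.treeHeight : ℝ) ≤ W.span := by
      have : W.treeHeight ≤ W.span := by unfold Workload.span; omega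
      exact_mod_cast this
    have e5 : (State.initial W).exposure (smallest W R) (largest W R) ≤ c * P * W.span :=
      e2.trans (mul_le_mul e3 e4 (Nat.cast_nonneg _) (by positivity))
    have e6 := mul_le_mul_of_nonneg_left e5 (show 0 ≤ 12 * μ by positivity)
    unfold State.ratioPotential
    linarith
  have h2 := (div_le_iff₀ hP').2 h1
  have h3 : (W.span : ℝ) ≤ W.span * μ := le_mul_of_one_le_right hs0 hμ
  have h4 : 36 * (1 + (16 + 48 * μ)) * (W.span : ℝ) = 612 * W.span + 1728 * (W.span * μ) := by ring
  rw [h4]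
  linarith

end LocalizedStealing

theorem theorem8 (c : ℝ) :
    ∃ C : ℝ, 0 < C ∧
      ∀ (P : ℕ) (W : LocalizedStealing.Workload P) (σ : LocalizedStealing.ContentionRule P)
        (R : Finset W.Task),
        0 < P → 1 ≤ W.treeHeight → (R.card : ℝ) ≤ c * P →
        LocalizedStealing.expectedTime σ W ≤
          ENNReal.ofReal
            ((W.work : ℝ) / P + C * ((W.span : ℝ) * min (W.maxRatio R) (W.treeHeight : ℝ))) := by
  -- The given `c` may be negative; the constant has to be positive all the same.
  have hC : (0 : ℝ) ≤ max c 0 := le_max_right _ _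
  refine ⟨2388 + 12 * max c 0, by positivity, fun P W σ R hP hH hR => ?_⟩
  rcases le_total (W.maxRatio R) (W.treeHeight : ℝ) with h | h
  · rw [min_eq_left h]
    exact LocalizedStealing.expectedTime_le_ratio σ W hP hH R hC
      (hR.trans (mul_le_mul_of_nonneg_right (le_max_left _ _) (Nat.cast_nonneg _)))
  · rw [min_eq_right h]
    refine (LocalizedStealing.expectedTime_le_height σ W hP hH).trans (ENNReal.ofReal_le_ofReal ?_)
    gcongr
    linarith
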